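/- Let $a>-1$, let $\mathbb H_a=L^2([0,\infty),e^{-at}\,dt)$, and let $Z$ be a centred Gaussian random element of $\mathbb H_a$ with covariance kernel $K_0(s,t)=e^{-\max(s,t)}-e^{-(s+t)}$, $s,t>0$; that is, the law of $Z$ is Gaussian, and for all $f,g\in\mathbb H_a$ one has $\mathbb E\langle f,Z\rangle_{\mathbb H_a}=0$ and $\operatorname{Cov}(\langle f,Z\rangle_{\mathbb H_a},\langle g,Z\rangle_{\mathbb H_a})=\int_0^\infty\!\int_0^\infty K_0(s,t)f(s)g(t)e^{-as}e^{-at}\,ds\,dt$. Let $K_1=K_0$ and $$K_j(s,t)=\int_0^\infty K_{j-1}(s,u)K_0(u,t)e^{-au}\,du,\qquad j\ge 2,\ s,t>0 .$$ Then these integrals converge, $\|Z\|_{\mathbb H_a}^2$ has a moment generating function that is finite in a neighbourhood of $0$, and its cumulants $\kappa_{j,a}$ (the derivatives at $0$ of $x\mapsto\log\mathbb E\, e^{x\|Z\|_{\mathbb H_a}^2}$) satisfy, for every $j\ge1$, $$\kappa_{j,a}=2^{j-1}(j-1)!\int_0^\infty K_j(t,t)e^{-at}\,dt,$$ where the integral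 converges. Moreover $$\kappa_{1,a}=\mathbb E\|Z\|_{\mathbb H_a}^2=\int_0^\infty K_0(t,t)e^{-at}\,dt=\frac1{(a+1)(a+2)},$$ $$\kappa_{2,a}=\mathbb V(\|Z\|_{\mathbb H_a}^2)=2\int_0^\infty\!\int_0^\infty K_0(s,t)^2e^{-a(s+t)}\,ds\,dt=\frac{2}{(a^2+3a+2)(2a+3)(a+2)},$$ where $\mathbb V$ denotes the variance and the double integral converges absolutely, and $$\kappa_{3,a}=\frac{16}{(1+a)(2a+3)(a+2)^3(3a+4)},\qquad \kappa_{4,a}=\frac{48(11a+16)}{(3a+4)(2a+3)^2(a+2)^4(1+a)(4a+5)} .$$ -/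

import Mathlib

open MeasureTheory ProbabilityTheory

noncomputable section

/-- The measure `exp (-a t) dt` on the half line `[0, ∞)`, as a measure on `ℝ`. -/
def expWeight (a : ℝ) : Measure ℝ :=
  (volume.restrict (Set.Ici 0)).withDensity fun t => ENNReal.ofReal (Real.exp (-a * t))

/-- The real Hilbert space `L²([0, ∞), exp (-a t) dt)`. -/
abbrev WeightedL2 (a : ℝ) : Type := Lp ℝ 2 (expWeight a)

instance (a : ℝ) : MeasurableSpace (WeightedL2 a) := borel _

instance (a : ℝ) : BorelSpace (WeightedL2 a) := ⟨rfl⟩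

/-- The covariance kernel `exp (-(s ∨ t)) - exp (-(s + t))`. -/
def K0 (s t : ℝ) : ℝ := Real.exp (-max s t) - Real.exp (-(s + t))

/-- The iterates of the kernel `K0` with respect to the weight `exp (-a u)` on `(0, ∞)`:
the first iterate is `K0` itself (which is also the value at index `0`). -/
def iterK (a : ℝ) : ℕ → ℝ → ℝ → ℝ
  | 0 => K0
  | 1 => K0
  | j + 2 => fun s t => ∫ u in Set.Ioi 0, iterK a (j + 1) s u * K0 u t * Real.exp (-a * u)

/-- `Z` is a centred Gaussian random element of `L²([0, ∞), exp (-a t) dt)` with covariance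
kernel `K`: its law is Gaussian, `⟨f, Z⟩` has mean zero for all `f`, and
`Cov (⟨f, Z⟩, ⟨g, Z⟩) = ∫∫ K(s, t) f(s) g(t) exp (-a s) exp (-a t) ds dt` for all `f`, `g`. -/
structure IsCentredGaussianWithKernel {Ω : Type*} [MeasurableSpace Ω] (a : ℝ) (K : ℝ → ℝ → ℝ)
    (Z : Ω → WeightedL2 a) (P : Measure Ω) : Prop where
  gaussian : HasGaussianLaw Z P
  centred : ∀ f : WeightedL2 a, ∫ ω, inner ℝ f (Z ω) ∂P = 0
  covariance_eq : ∀ f g : WeightedL2 a,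
    covariance (fun ω => inner ℝ f (Z ω)) (fun ω => inner ℝ g (Z ω)) P =
      ∫ s in Set.Ioi 0, ∫ t in Set.Ioi 0,
        K s t * f s * g t * Real.exp (-a * s) * Real.exp (-a * t)

/-- The `j`-th cumulant of a real random variable `X`: the `j`-th derivative at `0` of its
cumulant generating function `t ↦ log E[exp (t X)]`. It is meaningful when the moment generating
function is finite in a neighbourhood of `0`. -/
def cumulant {Ω : Type*} [MeasurableSpace Ω] (X : Ω → ℝ) (P : Measure Ω) (j : ℕ) : ℝ :=
  iteratedDeriv j (cgf X P) 0

end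

open Filter Topology
open scoped NNReal ENNReal

/-! ### Series and power series -/

section Series

variable {α ι : Type*} [MeasurableSpace α] {μ : Measure α} [Countable ι]

/-! The covariance operator `T` of $Z$ is the integral operator with kernel `K0`. It is positive
with trace $\mathbb E\|Z\|^2<\infty$, hence Hilbert–Schmidt, compact, and diagonal in a Hilbert
basis $b_i$ with eigenvalues $l_i\ge 0$. The coordinates $\langle b_i,Z\rangle$ are jointly Gaussian
and uncorrelated, so they are independent $N(0,l_i)$ variables and $\mathbb E
e^{x\|Z\|^2}=\prod_i(1-2xl_i)^{-1/2}$ near $0$. Expanding the logarithm shows that the $j$-th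
cumulant is $2^{j-1}(j-1)!\sum_i l_i^j$ (`cumulant_sq_norm`).

It remains to identify $\sum_i l_i^j$ with $\int K_j(t,t)e^{-at}\,dt$. For $j\ge2$,
$K_j(t,t)=\langle T^{j-2}k_t,k_t\rangle$ with $k_t=K_0(t,\cdot)$, and Parseval gives $\sum_i l_i^j
b_i(t)^2$, which integrates term by term (`integrable_and_hasSum_iterK_diag`). For $j=1$ this would
be Mercer's theorem; instead `K0` is factored through the explicit square root `rootK`, and Parseval
is applied to the sections of `rootK` (`hasSum_integral_K0_diag`).

The traces of order 2, 3, 4 are the double integrals of $K_0^2$, $K_2K_0$, $K_2^2$. By symmetry they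
reduce to $s<t$, where both kernels are combinations of exponentials in $t$. Integrating out $t$
leaves a polynomial in $e^{-s}$, $e^{-(1+a)s}$ and `lowerPart a s`. The last function solves a
first-order linear differential equation, so integration by parts lowers its power
(`integral_expMonomial`). -/

theorem integrable_and_hasSum_integral_of_nonneg {f : ι → α → ℝ} {g : α → ℝ}
    (hf : ∀ i, Integrable (f i) μ) (hf0 : ∀ i, 0 ≤ᵐ[μ] f i)
    (hs : Summable fun i => ∫ x, f i x ∂μ) (hg : ∀ᵐ x ∂μ, HasSum (fun i => f i x) (g x)) :
    Integrable g μ ∧ HasSum (fun i => ∫ x, f i x ∂μ) (∫ x, g x ∂μ) := by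
  have hn : ∀ i, ∫ x, ‖f i x‖ ∂μ = ∫ x, f i x ∂μ := fun i => by
    refine integral_congr_ae ?_
    filter_upwards [hf0 i] with x hx
    exact Real.norm_of_nonneg hx
  have hgt : g =ᵐ[μ] fun x => ∑' i, f i x := by
    filter_upwards [hg] with x hx using hx.tsum_eq.symm
  have hs' : Summable fun i => ∫ x, ‖f i x‖ ∂μ := by simpa only [hn] using hs
  have hall : ∀ᵐ x ∂μ, ∀ i, 0 ≤ f i x := ae_all_iff.2 hf0
  have hmeas : AEStronglyMeasurable g μ := by
    obtain ⟨u, hu⟩ := exists_seq_tendsto (atTop : Filter (Finset ι))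
    refine aestronglyMeasurable_of_tendsto_ae (u := atTop) (f := fun n x => ∑ i ∈ u n, f i x) ?_ ?_
    · intro n
      exact Finset.aestronglyMeasurable_fun_sum _ fun i _ => (hf i).1
    · filter_upwards [hg] with x hx using hx.comp hu
  refine ⟨⟨hmeas, ?_⟩, ?_⟩
  · have h1 : ∫⁻ x, ‖g x‖ₑ ∂μ = ∑' i, ∫⁻ x, ‖f i x‖ₑ ∂μ := by
      rw [← lintegral_tsum fun i => (hf i).1.enorm]
      refine lintegral_congr_ae ?_
      filter_upwards [hg, hall] with x hx h0
      have : ∀ i, ‖f i x‖ₑ = ENNReal.ofReal (f i x) := fun i => Real.enorm_of_nonneg (h0 i)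
      simp only [this]
      rw [← ENNReal.ofReal_tsum_of_nonneg h0 hx.summable, hx.tsum_eq,
        Real.enorm_of_nonneg (hx.nonneg h0)]
    have h2 : ∀ i, ∫⁻ x, ‖f i x‖ₑ ∂μ = ENNReal.ofReal (∫ x, f i x ∂μ) := fun i => by
      rw [← hn i, ofReal_integral_norm_eq_lintegral_enorm (hf i)]
    rw [hasFiniteIntegral_def, h1]
    simp only [h2]
    rw [← ENNReal.ofReal_tsum_of_nonneg (fun i => integral_nonneg_of_ae (hf0 i)) hs]
    exact ENNReal.ofReal_lt_top
  · rw [integral_congr_ae hgt]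
    exact hasSum_integral_of_summable_integral_norm hf hs'

/-- Partial sums of nonnegative terms stay below the integrable limit, which supplies the
summability of the integrals. -/
theorem hasSum_integral_of_nonneg_of_integrable {f : ι → α → ℝ} {g : α → ℝ}
    (hf : ∀ i, Integrable (f i) μ) (hf0 : ∀ i, 0 ≤ᵐ[μ] f i)
    (hgi : Integrable g μ) (hg : ∀ᵐ x ∂μ, HasSum (fun i => f i x) (g x)) :
    HasSum (fun i => ∫ x, f i x ∂μ) (∫ x, g x ∂μ) := by
  have hall : ∀ᵐ x ∂μ, ∀ i, 0 ≤ f i x := ae_all_iff.2 hf0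
  refine (integrable_and_hasSum_integral_of_nonneg hf hf0 ?_ hg).2
  refine summable_of_sum_le (c := ∫ x, g x ∂μ) (fun i => integral_nonneg_of_ae (hf0 i)) fun s => ?_
  rw [← integral_finsetSum _ fun i _ => hf i]
  refine integral_mono_ae (integrable_finsetSum _ fun i _ => hf i) hgi ?_
  filter_upwards [hg, hall] with x hx h0
  exact sum_le_hasSum s (fun i _ => h0 i) hx

/-- Uniqueness of power series: the given expansion must be the Taylor series. -/
theorem iteratedDeriv_zero_of_hasSum {f : ℝ → ℝ} {c : ℕ → ℝ} {r : ℝ} (hr : 0 < r)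
    (h : ∀ x, |x| < r → HasSum (fun n => c n * x ^ n) (f x)) (n : ℕ) :
    iteratedDeriv n f 0 = n.factorial * c n := by
  have hp : HasFPowerSeriesOnBall f (FormalMultilinearSeries.ofScalars ℝ c) 0
      (ENNReal.ofReal r) := by
    refine ⟨?_, by simpa using hr, ?_⟩
    · refine le_of_forall_lt fun y hy => ?_
      lift y to ℝ≥0 using hy.ne_top
      obtain ⟨z, hyz, hz⟩ := ENNReal.lt_iff_exists_nnreal_btwn.1 hy
      refine (ENNReal.coe_lt_coe.2 (ENNReal.coe_lt_coe.1 hyz)).trans_le ?_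
      refine FormalMultilinearSeries.le_radius_of_tendsto _ (l := 0) ?_
      have hz' : |(z : ℝ)| < r := by
        rw [abs_of_nonneg (NNReal.coe_nonneg z)]
        have := (ENNReal.lt_ofReal_iff_toReal_lt ENNReal.coe_ne_top).1 hz
        simpa using this
      have := (h z hz').summable.tendsto_atTop_zero.norm
      simpa [FormalMultilinearSeries.ofScalars_norm] using this
    · intro y hy
      have hy' : |y| < r := by
        simpa [ENNReal.ofReal_lt_ofReal_iff, edist_dist, hr] using hy
      simpa [FormalMultilinearSeries.ofScalars_apply_eq, mul_comm] using h y hy'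
  have h1 := hp.analyticAt.hasFPowerSeriesAt.eq_formalMultilinearSeries hp.hasFPowerSeriesAt
  have h2 : iteratedDeriv n f 0 / n.factorial = c n := by
    have := congrArg (fun p => FormalMultilinearSeries.coeff p n) h1
    simpa [FormalMultilinearSeries.coeff_ofScalars] using this
  rw [← h2]
  field_simp

end Series

/-! ### The square norm of a Gaussian vector -/

theorem integrable_and_integral_exp_sq_gaussianReal (v : ℝ≥0) {x : ℝ} (h : 2 * (x * v) < 1) :
    Integrable (fun y => Real.exp (x * y ^ 2)) (gaussianReal 0 v) ∧
      ∫ y, Real.exp (x * y ^ 2) ∂gaussianReal 0 v =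
        Real.exp (-Real.log (1 - 2 * (x * v)) / 2) := by
  rcases eq_or_ne v 0 with rfl | hv
  · simp [integrable_dirac]
  have hv0 : (0 : ℝ) < v := by positivity
  -- Here $c=\frac1{2v}-x$, the Gaussian exponent after absorbing $xy^2$; it is positive exactly
  -- when $2xv<1$.
  set c : ℝ := (1 - 2 * (x * v)) / (2 * v) with hc
  have hcpos : 0 < c := by rw [hc]; apply div_pos <;> linarith
  have key : ∀ y : ℝ, gaussianPDFReal 0 v y * Real.exp (x * y ^ 2) =
      (√(2 * Real.pi * v))⁻¹ * Real.exp (-c * y ^ 2) := fun y => by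
    rw [gaussianPDFReal_def, mul_assoc, ← Real.exp_add]
    congr 2
    rw [hc]; field_simp; ring
  constructor
  · rw [gaussianReal_of_var_ne_zero _ hv, integrable_withDensity_iff_integrable_smul₀'
      (measurable_gaussianPDF _ _).aemeasurable (by simp [gaussianPDF_lt_top])]
    simp only [toReal_gaussianPDF, smul_eq_mul, key]
    exact (integrable_exp_neg_mul_sq hcpos).const_mul _
  · rw [integral_gaussianReal_eq_integral_smul hv]
    simp only [smul_eq_mul, key]
    rw [integral_const_mul, integral_gaussian, ← Real.sqrt_inv, ← Real.sqrt_mul (by positivity)]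
    have h1 : 0 < 1 - 2 * (x * v) := by linarith
    have : (2 * Real.pi * (v : ℝ))⁻¹ * (Real.pi / c) = (1 - 2 * (x * v))⁻¹ := by
      rw [hc]; field_simp
    rw [this, Real.sqrt_eq_rpow, Real.rpow_def_of_pos (inv_pos.2 h1), Real.log_inv]
    congr 1; ring

theorem HilbertBasis.hasSum_sq_inner {ι H : Type*} [NormedAddCommGroup H] [InnerProductSpace ℝ H]
    (b : HilbertBasis ι ℝ H) (x : H) : HasSum (fun i => inner ℝ (b i) x ^ 2) (‖x‖ ^ 2) := by
  have h := b.hasSum_inner_mul_inner x x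
  rw [real_inner_self_eq_norm_sq] at h
  simpa only [real_inner_comm x, ← sq] using h

section GaussianHilbert

variable {Ω H ι : Type*} [MeasurableSpace Ω] {P : Measure Ω} [NormedAddCommGroup H]
  [InnerProductSpace ℝ H] [MeasurableSpace H] [BorelSpace H] {Z : Ω → H}
  (b : HilbertBasis ι ℝ H) {l : ι → ℝ}

theorem ProbabilityTheory.HasGaussianLaw.inner_const (hZ : HasGaussianLaw Z P) (f : H) :
    HasGaussianLaw (fun ω => inner ℝ f (Z ω)) P :=
  hZ.map_fun (innerSL ℝ f)

/-- A finite set of coordinates is jointly Gaussian with diagonal covariance, hence independent, so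
the expectation factors into one-dimensional Gaussian integrals. -/
theorem ProbabilityTheory.HasGaussianLaw.mgf_sum_sq_inner [DecidableEq ι]
    (hZ : HasGaussianLaw Z P) (hc : ∀ f : H, ∫ ω, inner ℝ f (Z ω) ∂P = 0)
    (hcov : ∀ i j, cov[fun ω => inner ℝ (b i) (Z ω), fun ω => inner ℝ (b j) (Z ω); P] =
      if i = j then l i else 0) {x : ℝ} (hx : ∀ i, 2 * (x * l i) < 1) (s : Finset ι) :
    ∫ ω, Real.exp (x * ∑ i ∈ s, inner ℝ (b i) (Z ω) ^ 2) ∂P =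
      Real.exp (∑ i ∈ s, -Real.log (1 - 2 * (x * l i)) / 2) := by
  have := hZ.isProbabilityMeasure
  let X : s → Ω → ℝ := fun i ω => inner ℝ (b i) (Z ω)
  have hX : HasGaussianLaw (fun ω => (X · ω)) P :=
    hZ.map_fun (ContinuousLinearMap.pi fun i : s => innerSL ℝ (b i))
  have hind : iIndepFun X P := hX.iIndepFun_of_covariance_eq_zero fun i j hij => by
    rw [hcov, if_neg fun h => hij (Subtype.ext h)]
  have hm : ∀ i, AEMeasurable (X i) P := fun i => (hX.eval i).aemeasurable
  have hind2 : iIndepFun (fun i ω => X i ω ^ 2) P :=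
    hind.comp (fun _ y => y ^ 2) fun _ => by fun_prop
  have h1 : ∀ i, mgf (fun ω => X i ω ^ 2) P x = Real.exp (-Real.log (1 - 2 * (x * l i)) / 2) := by
    intro i
    have hv : Var[X i; P] = l i := by
      rw [← covariance_self (hm i), hcov, if_pos rfl]
    have hl0 : 0 ≤ l i := hv ▸ variance_nonneg _ _
    have hlaw := (hX.eval i).map_eq_gaussianReal
    rw [hv, show ∫ ω, X i ω ∂P = 0 from hc _] at hlaw
    have := (integrable_and_integral_exp_sq_gaussianReal (l i).toNNReal
      (x := x) (by rw [Real.coe_toNNReal _ hl0]; exact hx i)).2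
    rw [← hlaw, integral_map (hm i) (by fun_prop), Real.coe_toNNReal _ hl0] at this
    exact this
  have h2 := hind2.mgf_sum₀ (t := x) (fun i => (hm i).pow_const 2) Finset.univ
  simp only [h1] at h2
  rw [← Real.exp_sum, Finset.sum_coe_sort s fun i => -Real.log (1 - 2 * (x * l i)) / 2] at h2
  rw [← h2, mgf]
  congr 1 with ω
  congr 2
  rw [Finset.sum_apply, ← Finset.sum_coe_sort s]

variable [CompleteSpace H] [SecondCountableTopology H]

/-- This is Fernique's theorem for the law of `Z`. -/
theorem ProbabilityTheory.HasGaussianLaw.exists_integrable_exp_sq (hZ : HasGaussianLaw Z P) :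
    ∃ C : ℝ, 0 < C ∧ ∀ x, |x| ≤ C → Integrable (fun ω => Real.exp (x * ‖Z ω‖ ^ 2)) P := by
  have := hZ.isGaussian_map
  obtain ⟨C, hC, h⟩ := IsGaussian.exists_integrable_exp_sq (P.map Z)
  refine ⟨C, hC, fun x hx => ?_⟩
  have h' := h.comp_aemeasurable hZ.aemeasurable
  have hm : AEMeasurable (fun ω => ‖Z ω‖) P := hZ.aemeasurable.norm
  refine h'.mono' (Real.measurable_exp.comp_aemeasurable
    ((hm.pow_const 2).const_mul x)).aestronglyMeasurable (ae_of_all _ fun ω => ?_)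
  simp only [Function.comp, Real.norm_eq_abs, Real.abs_exp]
  gcongr
  exact (le_abs_self x).trans hx

theorem ProbabilityTheory.HasGaussianLaw.zero_mem_interior_integrableExpSet
    (hZ : HasGaussianLaw Z P) :
    0 ∈ interior (integrableExpSet (fun ω => ‖Z ω‖ ^ 2) P) := by
  obtain ⟨C, hC, h⟩ := hZ.exists_integrable_exp_sq
  refine mem_interior_iff_mem_nhds.2 (Filter.mem_of_superset (Metric.ball_mem_nhds 0 hC) ?_)
  intro x hx
  exact h x (by simpa using (Metric.mem_ball.1 hx).le)

theorem ProbabilityTheory.HasGaussianLaw.integrable_sq_norm (hZ : HasGaussianLaw Z P) :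
    Integrable (fun ω => ‖Z ω‖ ^ 2) P :=
  hZ.memLp_two.integrable_norm_pow (by norm_num)

variable [Countable ι]

theorem ProbabilityTheory.HasGaussianLaw.hasSum_variance_inner (hZ : HasGaussianLaw Z P)
    (hc : ∀ f : H, ∫ ω, inner ℝ f (Z ω) ∂P = 0)
    (hl : ∀ i, Var[fun ω => inner ℝ (b i) (Z ω); P] = l i) :
    HasSum l (∫ ω, ‖Z ω‖ ^ 2 ∂P) := by
  have := hZ.isProbabilityMeasure
  have h2 : ∀ i, MemLp (fun ω => inner ℝ (b i) (Z ω)) 2 P := fun i => (hZ.inner_const _).memLp_two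
  have hl' : l = fun i => ∫ ω, inner ℝ (b i) (Z ω) ^ 2 ∂P := by
    funext i
    rw [← hl i, variance_of_integral_eq_zero (h2 i).1.aemeasurable (hc _)]
  rw [hl']
  exact hasSum_integral_of_nonneg_of_integrable (fun i => (h2 i).integrable_sq)
    (fun i => ae_of_all _ fun ω => sq_nonneg _) hZ.integrable_sq_norm
    (ae_of_all _ fun ω => b.hasSum_sq_inner _)

theorem ProbabilityTheory.HasGaussianLaw.exists_hasSum_cgf_sq_norm [DecidableEq ι]
    (hZ : HasGaussianLaw Z P) (hc : ∀ f : H, ∫ ω, inner ℝ f (Z ω) ∂P = 0)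
    (hcov : ∀ i j, cov[fun ω => inner ℝ (b i) (Z ω), fun ω => inner ℝ (b j) (Z ω); P] =
      if i = j then l i else 0) (hl0 : ∀ i, 0 ≤ l i) (hl : Summable l) :
    ∃ r : ℝ, 0 < r ∧ ∀ x, |x| < r → HasSum (fun j : ℕ => (2 ^ j / (j + 1) * ∑' i, l i ^ (j + 1)) *
      x ^ (j + 1)) (cgf (fun ω => ‖Z ω‖ ^ 2) P x) := by
  have := hZ.isProbabilityMeasure
  obtain ⟨C, hC, hint⟩ := hZ.exists_integrable_exp_sq
  set τ := ∑' i, l i with hτ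
  have hτ0 : 0 ≤ τ := tsum_nonneg hl0
  have hlτ : ∀ i, l i ≤ τ := fun i => hl.le_tsum i fun j _ => hl0 j
  -- The first bound gives integrability; the second forces $|2xl_i|\le 1/2$ for every $i$, as
  -- $l_i\le\tau$, so all logarithmic series converge uniformly geometrically. The `+ 1` covers
  -- $\tau=0$.
  refine ⟨min C (1 / (4 * (τ + 1))), by positivity, fun x hx => ?_⟩
  have hxC : |x| ≤ C := (hx.trans_le (min_le_left _ _)).le
  have hxτ : |x| * (4 * (τ + 1)) ≤ 1 := by
    have := (hx.trans_le (min_le_right _ _)).le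
    rwa [le_div_iff₀ (by positivity)] at this
  have hy : ∀ i, |2 * (x * l i)| ≤ 1 / 2 := fun i => by
    rw [abs_mul, abs_mul, abs_of_nonneg (hl0 i), abs_two]
    have := mul_le_mul_of_nonneg_left (hlτ i) (abs_nonneg x)
    nlinarith [abs_nonneg x]
  have hy1 : ∀ i, |2 * (x * l i)| < 1 := fun i => (hy i).trans_lt (by norm_num)
  let f : ι × ℕ → ℝ := fun p => (2 * (x * l p.1)) ^ (p.2 + 1) / (p.2 + 1) / 2
  have hf : Summable f := by
    have hg : Summable fun p : ι × ℕ => |x| * l p.1 * (1 / 2 : ℝ) ^ p.2 :=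
      (hl.mul_left |x|).mul_of_nonneg (summable_geometric_of_lt_one (by norm_num) (by norm_num))
        (fun i => mul_nonneg (abs_nonneg x) (hl0 i)) fun n => by positivity
    refine hg.of_norm_bounded fun p => ?_
    simp only [f, norm_div, Real.norm_eq_abs, abs_pow, pow_succ |2 * (x * l p.1)|]
    have h1 : |2 * (x * l p.1)| ^ p.2 ≤ (1 / 2) ^ p.2 := pow_le_pow_left₀ (abs_nonneg _) (hy _) _
    have h2 : |2 * (x * l p.1)| = 2 * (|x| * l p.1) := by
      rw [abs_mul, abs_mul, abs_of_nonneg (hl0 _), abs_two]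
    have h3 : (1 : ℝ) ≤ |(p.2 : ℝ) + 1| := by
      rw [abs_of_nonneg (by positivity)]; linarith [Nat.cast_nonneg (α := ℝ) p.2]
    calc |2 * (x * l p.1)| ^ p.2 * |2 * (x * l p.1)| / |(p.2 : ℝ) + 1| / |2|
        ≤ |2 * (x * l p.1)| ^ p.2 * |2 * (x * l p.1)| / 1 / |2| := by gcongr
      _ = |2 * (x * l p.1)| ^ p.2 * (|x| * l p.1) := by
        nth_rewrite 2 [h2]; rw [abs_two]; ring
      _ ≤ (1 / 2) ^ p.2 * (|x| * l p.1) := by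
        have := mul_nonneg (abs_nonneg x) (hl0 p.1)
        gcongr
      _ = |x| * l p.1 * (1 / 2) ^ p.2 := mul_comm _ _
  have hrow : ∀ i, HasSum (fun j => f (i, j)) (-Real.log (1 - 2 * (x * l i)) / 2) := fun i =>
    (Real.hasSum_pow_div_log_of_abs_lt_one (hy1 i)).div_const 2
  have hsum := hf.hasSum.prod_fiberwise hrow
  have hcol : HasSum (fun j => ∑' i, f (i, j)) (∑' p, f p) := by
    have h := (Equiv.prodComm ℕ ι).hasSum_iff.2 hf.hasSum
    exact h.prod_fiberwise fun j => (hf.prod_symm.prod_factor j).hasSum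
  -- The row sums of the double series give the logarithm of the infinite product. That product is
  -- reached from finite sets of coordinates by dominated convergence, with majorant
  -- $e^{|x|\|Z\|^2}$.
  have hcgf : cgf (fun ω => ‖Z ω‖ ^ 2) P x = ∑' p, f p := by
    have ht1 : Tendsto (fun s : Finset ι => ∫ ω, Real.exp (x * ∑ i ∈ s, inner ℝ (b i) (Z ω) ^ 2) ∂P)
        atTop (𝓝 (∫ ω, Real.exp (x * ‖Z ω‖ ^ 2) ∂P)) := by
      refine tendsto_integral_filter_of_dominated_convergence
        (fun ω => Real.exp (|x| * ‖Z ω‖ ^ 2)) ?_ ?_ (hint _ (by simpa using hxC)) ?_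
      · refine Eventually.of_forall fun s => ?_
        have : ∀ i, AEMeasurable (fun ω => inner ℝ (b i) (Z ω)) P := fun i =>
          (hZ.inner_const (b i)).aemeasurable
        refine AEMeasurable.aestronglyMeasurable ?_
        refine Real.measurable_exp.comp_aemeasurable (AEMeasurable.const_mul ?_ _)
        exact Finset.aemeasurable_fun_sum _ fun i _ => (this i).pow_const 2
      · refine Eventually.of_forall fun s => ae_of_all _ fun ω => ?_
        rw [Real.norm_eq_abs, Real.abs_exp]
        refine Real.exp_le_exp.2 ?_
        have h0 : 0 ≤ ∑ i ∈ s, inner ℝ (b i) (Z ω) ^ 2 := Finset.sum_nonneg fun i _ => sq_nonneg _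
        have h1 : ∑ i ∈ s, inner ℝ (b i) (Z ω) ^ 2 ≤ ‖Z ω‖ ^ 2 :=
          sum_le_hasSum s (fun i _ => sq_nonneg _) (b.hasSum_sq_inner (Z ω))
        exact mul_le_mul (le_abs_self x) h1 h0 (abs_nonneg x)
      · refine ae_of_all _ fun ω => ?_
        exact (Real.continuous_exp.tendsto _).comp ((b.hasSum_sq_inner (Z ω)).const_mul x)
    have hlt : ∀ i, 2 * (x * l i) < 1 := fun i => (le_abs_self _).trans_lt (hy1 i)
    simp only [hZ.mgf_sum_sq_inner b hc hcov hlt] at ht1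
    have ht2 := (Real.continuous_exp.tendsto _).comp hsum
    rw [cgf, mgf, tendsto_nhds_unique ht1 ht2, Real.log_exp]
  rw [hcgf]
  convert hcol using 2 with j
  rw [mul_right_comm, ← tsum_mul_left]
  refine tsum_congr fun i => ?_
  simp only [f]
  rw [mul_pow, mul_pow, pow_succ]
  ring

theorem ProbabilityTheory.HasGaussianLaw.cumulant_sq_norm [DecidableEq ι]
    (hZ : HasGaussianLaw Z P) (hc : ∀ f : H, ∫ ω, inner ℝ f (Z ω) ∂P = 0)
    (hcov : ∀ i j, cov[fun ω => inner ℝ (b i) (Z ω), fun ω => inner ℝ (b j) (Z ω); P] =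
      if i = j then l i else 0) (hl0 : ∀ i, 0 ≤ l i) (hl : Summable l) (j : ℕ) :
    cumulant (fun ω => ‖Z ω‖ ^ 2) P (j + 1) =
      2 ^ j * (j.factorial : ℝ) * ∑' i, l i ^ (j + 1) := by
  obtain ⟨r, hr, h⟩ := hZ.exists_hasSum_cgf_sq_norm b hc hcov hl0 hl
  -- The series for the cumulant generating function starts at $x^1$; the constant coefficient is
  -- $0$.
  let c : ℕ → ℝ := fun n => Nat.casesOn n 0 fun j => 2 ^ j / (j + 1) * ∑' i, l i ^ (j + 1)
  have h' : ∀ x, |x| < r → HasSum (fun n => c n * x ^ n) (cgf (fun ω => ‖Z ω‖ ^ 2) P x) := by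
    intro x hx
    have := (hasSum_nat_add_iff (f := fun n => c n * x ^ n) 1).1 (h x hx)
    simpa [c] using this
  rw [cumulant, iteratedDeriv_zero_of_hasSum hr h' (j + 1), Nat.factorial_succ]
  simp only [c]
  push_cast
  field_simp

end GaussianHilbert

/-! ### Diagonalization of covariance operators -/

section Spectral

variable {H ι : Type*} [NormedAddCommGroup H] [InnerProductSpace ℝ H]

theorem Orthonormal.countable [TopologicalSpace.SeparableSpace H] {v : ι → H}
    (hv : Orthonormal ℝ v) : Countable ι := by
  refine Pairwise.countable_of_isOpen_disjoint (s := fun i => Metric.ball (v i) (1 / 2))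
    (fun i j hij => ?_) (fun i => Metric.isOpen_ball) fun i => Metric.nonempty_ball.2 (by norm_num)
  refine Metric.ball_disjoint_ball ?_
  have h : ‖v i - v j‖ ^ 2 = 2 := by
    rw [norm_sub_sq_real, hv.2 hij, hv.1 i, hv.1 j]; norm_num
  rw [dist_eq_norm]
  nlinarith [norm_nonneg (v i - v j)]

/-- A Hilbert–Schmidt operator is a norm limit of its finite-rank truncations `F s`, which keep the
coordinates of `T x` in `s`. By symmetry and Cauchy–Schwarz, the squared error is at most the tail
$\sum_{i\notin s}\|Tb_i\|^2$. -/
theorem ContinuousLinearMap.isCompactOperator_of_summable_sq_norm [CompleteSpace H]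
    (b : HilbertBasis ι ℝ H) {T : H →L[ℝ] H} (hT : T.toLinearMap.IsSymmetric)
    (hs : Summable fun i => ‖T (b i)‖ ^ 2) : IsCompactOperator T := by
  classical
  let F : Finset ι → H →L[ℝ] H := fun s => ∑ i ∈ s, (innerSL ℝ (T (b i))).smulRight (b i)
  have hF : ∀ s x, F s x = ∑ i ∈ s, inner ℝ (T (b i)) x • b i := fun s x => by
    simp [F]
  have hcomp : ∀ s, IsCompactOperator (F s) := fun s => by
    have h1 : ∀ i, (innerSL ℝ (T (b i))).smulRight (b i) ∈ compactOperator (RingHom.id ℝ) H H := by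
      intro i
      have : IsCompactOperator (innerSL ℝ (T (b i))) :=
        isCompactOperator_of_locallyCompactSpace_dom (innerSL ℝ (T (b i)))
      exact this.clm_comp (ContinuousLinearMap.toSpanSingleton ℝ (b i))
    exact Submodule.sum_mem _ fun i _ => h1 i
  have hb : ∀ s, ‖F s - T‖ ≤ √(∑' i, ‖T (b i)‖ ^ 2 - ∑ i ∈ s, ‖T (b i)‖ ^ 2) := fun s => by
    refine ContinuousLinearMap.opNorm_le_bound _ (Real.sqrt_nonneg _) fun x => ?_
    have hd : 0 ≤ ∑' i, ‖T (b i)‖ ^ 2 - ∑ i ∈ s, ‖T (b i)‖ ^ 2 :=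
      sub_nonneg.2 (hs.sum_le_tsum s fun i _ => sq_nonneg _)
    refine le_of_sq_le_sq ?_ (by positivity)
    rw [mul_pow, Real.sq_sqrt hd]
    have h1 := b.hasSum_sq_inner ((F s - T) x)
    have h2 : HasSum (fun i => (‖T (b i)‖ ^ 2 - if i ∈ s then ‖T (b i)‖ ^ 2 else 0) * ‖x‖ ^ 2)
        ((∑' i, ‖T (b i)‖ ^ 2 - ∑ i ∈ s, ‖T (b i)‖ ^ 2) * ‖x‖ ^ 2) := by
      refine (hs.hasSum.sub ?_).mul_right _
      have := hasSum_sum_of_ne_finset_zero (f := fun i => if i ∈ s then ‖T (b i)‖ ^ 2 else 0)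
        (s := s) (L := .unconditional ι)
        fun i hi => if_neg hi
      simpa only [Finset.sum_ite_mem, Finset.inter_self] using this
    refine hasSum_le (fun i => ?_) h1 h2
    have h3 : inner ℝ (b i) (T x) = inner ℝ (T (b i)) x := (hT (b i) x).symm
    have h4 : inner ℝ (b i) (F s x) = if i ∈ s then inner ℝ (T (b i)) x else 0 := by
      rw [hF, inner_sum]
      simp [inner_smul_right, orthonormal_iff_ite.1 b.orthonormal]
    rw [sub_apply, inner_sub_right, h3, h4]
    split_ifs
    · simp
    · rw [zero_sub, neg_sq, sub_zero, ← mul_pow]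
      exact sq_le_sq' (by linarith [neg_le_of_abs_le (abs_real_inner_le_norm (T (b i)) x)])
        (real_inner_le_norm _ _)
  refine isCompactOperator_of_tendsto (l := atTop) (F := F) ?_ (Eventually.of_forall hcomp)
  rw [tendsto_iff_norm_sub_tendsto_zero]
  refine squeeze_zero (fun _ => norm_nonneg _) hb ?_
  have : Tendsto (fun s => ∑' i, ‖T (b i)‖ ^ 2 - ∑ i ∈ s, ‖T (b i)‖ ^ 2) atTop (𝓝 0) := by
    have := Tendsto.const_sub (∑' i, ‖T (b i)‖ ^ 2) hs.hasSum
    rwa [sub_self] at this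
  simpa using this.sqrt

/-- Expand $0\le\langle T(Mx-Tx),Mx-Tx\rangle$ with $M=\|T\|+1$, bound $\langle T^2x,Tx\rangle\le
M\|Tx\|^2$, and divide by $M$, which is positive thanks to the added $1$. This turns finite trace
into the Hilbert–Schmidt condition. -/
theorem ContinuousLinearMap.sq_norm_apply_le_of_nonneg {T : H →L[ℝ] H}
    (hT : T.toLinearMap.IsSymmetric) (hpos : ∀ x, 0 ≤ inner ℝ (T x) x) (x : H) :
    ‖T x‖ ^ 2 ≤ (‖T‖ + 1) * inner ℝ (T x) x := by
  set M := ‖T‖ + 1 with hM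
  have hM0 : 0 < M := by positivity
  have h1 : inner ℝ (T (T x)) (T x) ≤ M * ‖T x‖ ^ 2 := by
    calc inner ℝ (T (T x)) (T x) ≤ ‖T (T x)‖ * ‖T x‖ := real_inner_le_norm _ _
      _ ≤ ‖T‖ * ‖T x‖ * ‖T x‖ := by gcongr; exact T.le_opNorm _
      _ ≤ M * ‖T x‖ ^ 2 := by rw [hM]; nlinarith [sq_nonneg ‖T x‖]
  have h2 := hpos (M • x - T x)
  have h3 : inner ℝ (T (T x)) x = ‖T x‖ ^ 2 := by
    rw [← real_inner_self_eq_norm_sq]; exact hT (T x) x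
  rw [map_sub, map_smul, inner_sub_left, inner_sub_right, inner_sub_right, inner_smul_left,
    inner_smul_left, inner_smul_right, inner_smul_right, real_inner_self_eq_norm_sq, h3] at h2
  simp only [conj_trivial] at h2
  have h4 : 0 ≤ M * (M * inner ℝ (T x) x - ‖T x‖ ^ 2) := by linarith
  linarith [nonneg_of_mul_nonneg_right h4 hM0]

/-- Bases of all eigenspaces are collected, over every real number (most eigenspaces being zero).
The spectral theorem for compact symmetric operators leaves no orthogonal complement. -/
theorem ContinuousLinearMap.exists_hilbertBasis_eigenvectors.{u} {H : Type u}
    [NormedAddCommGroup H] [InnerProductSpace ℝ H] [CompleteSpace H] {T : H →L[ℝ] H}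
    (hc : IsCompactOperator T) (hT : T.toLinearMap.IsSymmetric) :
    ∃ (ι : Type u) (b : HilbertBasis ι ℝ H) (l : ι → ℝ), ∀ i, T (b i) = l i • b i := by
  have hcomplete : ∀ m : ℝ, CompleteSpace (Module.End.eigenspace T.toLinearMap m) := fun m => by
    have : IsClosed (Module.End.eigenspace T.toLinearMap m : Set H) := by
      have h : (Module.End.eigenspace T.toLinearMap m : Set H) = {x | T x = m • x} := by
        ext x; simp
      rw [h]
      exact isClosed_eq T.continuous (continuous_const_smul m)
    exact this.completeSpace_coe
  choose w b hb using fun m : ℝ => exists_hilbertBasis ℝ (Module.End.eigenspace T.toLinearMap m)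
  let v : (Σ m, w m) → H := fun p => (b p.1 p.2 : H)
  have hon : Orthonormal ℝ v := hT.orthogonalFamily_eigenspaces.orthonormal_sigma_orthonormal
    fun m => (b m).orthonormal
  have hbot : (Submodule.span ℝ (Set.range v))ᗮ = ⊥ := by
    rw [eq_bot_iff, ← ContinuousLinearMap.orthogonalComplement_iSup_eigenspaces_eq_bot hc hT]
    intro x hx
    rw [Submodule.mem_orthogonal] at hx
    rw [← Submodule.iInf_orthogonal, Submodule.mem_iInf]
    intro m
    rw [Submodule.mem_orthogonal]
    intro y hy
    have hs := ((b m).hasSum_repr ⟨y, hy⟩).mapL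
      ((innerSL ℝ x) ∘L (Module.End.eigenspace T.toLinearMap m).subtypeL)
    have h0 : ∀ i, inner ℝ x (b m i : H) = 0 := fun i => by
      rw [real_inner_comm]
      exact hx _ (Submodule.subset_span ⟨⟨m, i⟩, rfl⟩)
    rw [real_inner_comm]
    refine hs.unique ?_
    simp [h0]
  refine ⟨Σ m, w m, HilbertBasis.mkOfOrthogonalEqBot (v := v) hon hbot, fun p => p.1, fun p => ?_⟩
  rw [HilbertBasis.coe_mkOfOrthogonalEqBot]
  exact Module.End.mem_eigenspace_iff.1 (b p.1 p.2).2

end Spectral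

/-! ### The covariance operator and its eigenbasis -/

section Covariance

variable {Ω : Type*} [MeasurableSpace Ω] {P : Measure Ω}

theorem ProbabilityTheory.HasGaussianLaw.exists_eigenbasis.{u} {H : Type u} [NormedAddCommGroup H]
    [InnerProductSpace ℝ H] [CompleteSpace H] [SecondCountableTopology H] [MeasurableSpace H]
    [BorelSpace H] {Z : Ω → H} (hZ : HasGaussianLaw Z P)
    (hc : ∀ f : H, ∫ ω, inner ℝ f (Z ω) ∂P = 0) :
    ∃ (T : H →L[ℝ] H) (ι : Type u) (_ : Countable ι) (b : HilbertBasis ι ℝ H) (l : ι → ℝ),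
      (∀ f g, inner ℝ (T f) g =
        cov[fun ω => inner ℝ f (Z ω), fun ω => inner ℝ g (Z ω); P]) ∧
      (∀ f g, inner ℝ (T f) g = inner ℝ f (T g)) ∧
      (∀ i, T (b i) = l i • b i) ∧ (∀ i, 0 ≤ l i) ∧ HasSum l (∫ ω, ‖Z ω‖ ^ 2 ∂P) := by
  have := hZ.isProbabilityMeasure
  have := hZ.isGaussian_map
  have hmem : MemLp id 2 (P.map Z) := IsGaussian.memLp_two_id
  let T := covarianceOperator (P.map Z)
  have hpos : T.toLinearMap.IsPositive := isPositive_covarianceOperator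
  have h2 : ∀ f : H, MemLp (fun ω => inner ℝ f (Z ω)) 2 P := fun f => (hZ.inner_const f).memLp_two
  have hTcov : ∀ f g, inner ℝ (T f) g =
      cov[fun ω => inner ℝ f (Z ω), fun ω => inner ℝ g (Z ω); P] := fun f g => by
    rw [covarianceOperator_inner hmem, integral_map hZ.aemeasurable (by fun_prop),
      covariance_eq_sub (h2 f) (h2 g), hc f, zero_mul, sub_zero]
    rfl
  have hsym : ∀ f g, inner ℝ (T f) g = inner ℝ f (T g) := hpos.isSymmetric
  have hvar : ∀ f, Var[fun ω => inner ℝ f (Z ω); P] = inner ℝ (T f) f := fun f => by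
    rw [hTcov, covariance_self (h2 f).1.aemeasurable]
  -- In any Hilbert basis the variances of the coordinates sum to $\mathbb E\|Z\|^2$, so the trace
  -- is finite.
  have hcpt : IsCompactOperator T := by
    obtain ⟨w, b, -⟩ := exists_hilbertBasis ℝ H
    have : Countable w := b.orthonormal.countable
    have hs := (hZ.hasSum_variance_inner b hc fun i => hvar (b i)).summable
    refine ContinuousLinearMap.isCompactOperator_of_summable_sq_norm b hpos.isSymmetric ?_
    exact (hs.mul_left (‖T‖ + 1)).of_nonneg_of_le (fun i => sq_nonneg _) fun i =>
      ContinuousLinearMap.sq_norm_apply_le_of_nonneg hpos.isSymmetric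
        (fun x => by simpa using hpos.re_inner_nonneg_left x) _
  obtain ⟨ι, b, l, hb⟩ := T.exists_hilbertBasis_eigenvectors hcpt hpos.isSymmetric
  have hcount : Countable ι := b.orthonormal.countable
  have hl : ∀ i, Var[fun ω => inner ℝ (b i) (Z ω); P] = l i := fun i => by
    rw [hvar, hb, inner_smul_left, real_inner_self_eq_norm_sq, b.orthonormal.1 i]
    simp
  exact ⟨T, ι, hcount, b, l, hTcov, hsym, hb, fun i => hl i ▸ variance_nonneg _ _,
    hZ.hasSum_variance_inner b hc hl⟩

end Covariance

/-! ### The weighted space and the covariance kernel -/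

section Weight

variable (a : ℝ)

instance : SigmaFinite (expWeight a) := by
  unfold expWeight
  exact SigmaFinite.withDensity_ofReal _

instance : SecondCountableTopology (WeightedL2 a) := by
  have : Fact ((2 : ℝ≥0∞) ≠ ⊤) := ⟨by simp⟩
  infer_instance

variable {a}

theorem measurable_ofReal_exp_mul : Measurable fun t : ℝ => ENNReal.ofReal (Real.exp (-a * t)) := by
  fun_prop

theorem ae_expWeight_iff {p : ℝ → Prop} :
    (∀ᵐ t ∂expWeight a, p t) ↔ ∀ᵐ t ∂volume.restrict (Set.Ioi 0), p t := by
  rw [expWeight, ae_withDensity_iff measurable_ofReal_exp_mul, restrict_Ioi_eq_restrict_Ici]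
  simp [Real.exp_pos]

theorem integrable_expWeight_iff {f : ℝ → ℝ} : Integrable f (expWeight a) ↔
    IntegrableOn (fun t => f t * Real.exp (-a * t)) (Set.Ioi 0) := by
  rw [expWeight, integrable_withDensity_iff measurable_ofReal_exp_mul (by simp), IntegrableOn,
    restrict_Ioi_eq_restrict_Ici]
  simp [ENNReal.toReal_ofReal, Real.exp_nonneg]

theorem integral_expWeight (f : ℝ → ℝ) :
    ∫ t, f t ∂expWeight a = ∫ t in Set.Ioi 0, f t * Real.exp (-a * t) := by
  rw [expWeight, integral_withDensity_eq_integral_toReal_smul measurable_ofReal_exp_mul (by simp),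
    restrict_Ioi_eq_restrict_Ici]
  simp [ENNReal.toReal_ofReal, Real.exp_nonneg, mul_comm]

theorem integrable_exp_neg_expWeight {c : ℝ} (hc : 0 < a + c) :
    Integrable (fun t => Real.exp (-c * t)) (expWeight a) := by
  rw [integrable_expWeight_iff]
  have := exp_neg_integrableOn_Ioi 0 hc
  refine this.congr_fun (fun t _ => ?_) measurableSet_Ioi
  simp only [← Real.exp_add]
  ring_nf

end Weight

/-! ### Bounds on the kernel and its integral operator -/

section Kernel

theorem continuous_uncurry_K0 : Continuous (Function.uncurry K0) := by
  unfold K0 Function.uncurry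
  fun_prop

theorem K0_comm (s t : ℝ) : K0 s t = K0 t s := by
  rw [K0, K0, max_comm, add_comm]

theorem K0_nonneg {s t : ℝ} (hs : 0 ≤ s) (ht : 0 ≤ t) : 0 ≤ K0 s t := by
  rw [K0, sub_nonneg, Real.exp_le_exp]
  have : max s t ≤ s + t := max_le (by linarith) (by linarith)
  linarith

theorem K0_of_le {s t : ℝ} (h : s ≤ t) : K0 s t = (1 - Real.exp (-s)) * Real.exp (-t) := by
  rw [K0, max_eq_right h, neg_add, Real.exp_add]
  ring

theorem abs_K0_le (s t : ℝ) : |K0 s t| ≤ (1 + Real.exp (-s)) * Real.exp (-t) := by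
  have h1 : Real.exp (-max s t) ≤ Real.exp (-t) := Real.exp_le_exp.2 (by simp)
  have h2 : Real.exp (-(s + t)) = Real.exp (-s) * Real.exp (-t) := by rw [neg_add, Real.exp_add]
  rw [K0, h2, abs_le]
  constructor <;> nlinarith [Real.exp_pos (-max s t), Real.exp_pos (-s), Real.exp_pos (-t),
    mul_pos (Real.exp_pos (-s)) (Real.exp_pos (-t))]

/-- Splitting $e^{-2\max(s,t)}$ between the two variables gives a product majorant, integrable
against the weights because $a>-1$. -/
theorem K0_sq_le {s t : ℝ} (hs : 0 ≤ s) (ht : 0 ≤ t) :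
    K0 s t ^ 2 ≤ Real.exp (-s) * Real.exp (-t) := by
  have h1 : K0 s t ≤ Real.exp (-max s t) := sub_le_self _ (Real.exp_nonneg _)
  calc K0 s t ^ 2 ≤ Real.exp (-max s t) ^ 2 := pow_le_pow_left₀ (K0_nonneg hs ht) h1 2
    _ ≤ Real.exp (-s) * Real.exp (-t) := by
      rw [sq]
      gcongr <;> simp

variable {a : ℝ}

theorem memLp_K0 (ha : -1 < a) (s : ℝ) : MemLp (K0 s) 2 (expWeight a) := by
  have hm : AEStronglyMeasurable (K0 s) (expWeight a) :=
    (continuous_uncurry_K0.comp (Continuous.prodMk_right s)).aestronglyMeasurable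
  have h : MemLp (fun t => (1 + Real.exp (-s)) * Real.exp (-t)) 2 (expWeight a) := by
    refine MemLp.const_mul ?_ _
    rw [memLp_two_iff_integrable_sq (by fun_prop)]
    refine (integrable_exp_neg_expWeight (a := a) (c := 2) (by linarith)).congr
      (ae_of_all _ fun t => ?_)
    simp only [sq, ← Real.exp_add]
    ring_nf
  refine h.of_le hm (ae_of_all _ fun t => ?_)
  rw [Real.norm_eq_abs]
  exact (abs_K0_le s t).trans (le_abs_self _)

/-- The section `K0 s` of the covariance kernel as an element of the weighted space. -/
noncomputable def kernelSection (ha : -1 < a) (s : ℝ) : WeightedL2 a := (memLp_K0 ha s).toLp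

theorem inner_kernelSection_right (ha : -1 < a) (f : WeightedL2 a) (s : ℝ) :
    inner ℝ f (kernelSection ha s) = ∫ t, f t * K0 s t ∂expWeight a := by
  rw [L2.inner_def]
  refine integral_congr_ae ?_
  filter_upwards [(memLp_K0 ha s).coeFn_toLp] with t ht
  rw [kernelSection, ht]
  simp [mul_comm]

theorem sq_norm_kernelSection (ha : -1 < a) (s : ℝ) :
    ‖kernelSection ha s‖ ^ 2 = ∫ t, K0 s t ^ 2 ∂expWeight a := by
  rw [← real_inner_self_eq_norm_sq, inner_kernelSection_right]
  refine integral_congr_ae ?_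
  filter_upwards [(memLp_K0 ha s).coeFn_toLp] with t ht
  rw [kernelSection, ht, sq]

theorem ae_pos_expWeight : ∀ᵐ t ∂expWeight a, 0 < t :=
  ae_expWeight_iff.2 (ae_restrict_mem measurableSet_Ioi)

theorem ae_pos_prod_expWeight :
    ∀ᵐ p ∂(expWeight a).prod (expWeight a), 0 < p.1 ∧ 0 < p.2 := by
  refine (Measure.ae_prod_iff_ae_ae (p := fun p : ℝ × ℝ => 0 < p.1 ∧ 0 < p.2)
    ((measurableSet_lt measurable_const measurable_fst).inter
      (measurableSet_lt measurable_const measurable_snd))).2 ?_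
  filter_upwards [ae_pos_expWeight] with s hs
  filter_upwards [ae_pos_expWeight] with t ht using ⟨hs, ht⟩

theorem integrable_K0_sq_prod (ha : -1 < a) :
    Integrable (fun p : ℝ × ℝ => K0 p.1 p.2 ^ 2) ((expWeight a).prod (expWeight a)) := by
  have he : Integrable (fun t => Real.exp (-t)) (expWeight a) := by
    simpa using integrable_exp_neg_expWeight (a := a) (c := 1) (by linarith)
  refine (he.mul_prod he).mono' (continuous_uncurry_K0.pow 2).aestronglyMeasurable ?_
  filter_upwards [ae_pos_prod_expWeight] with p hp
  rw [Real.norm_of_nonneg (sq_nonneg _)]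
  exact K0_sq_le hp.1.le hp.2.le

theorem integrable_sq_norm_kernelSection (ha : -1 < a) :
    Integrable (fun s => ‖kernelSection ha s‖ ^ 2) (expWeight a) := by
  simp only [sq_norm_kernelSection]
  exact (integrable_K0_sq_prod ha).integral_prod_left

theorem memLp_inner_kernelSection (ha : -1 < a) (f : WeightedL2 a) :
    MemLp (fun s => inner ℝ f (kernelSection ha s)) 2 (expWeight a) := by
  have hm : AEStronglyMeasurable (fun s => inner ℝ f (kernelSection ha s)) (expWeight a) := by
    simp only [inner_kernelSection_right]
    have h : StronglyMeasurable fun p : ℝ × ℝ => f p.2 * K0 p.1 p.2 :=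
      ((Lp.stronglyMeasurable f).comp_measurable measurable_snd).mul
        continuous_uncurry_K0.stronglyMeasurable
    exact h.integral_prod_right'.aestronglyMeasurable
  rw [memLp_two_iff_integrable_sq hm]
  refine ((integrable_sq_norm_kernelSection ha).const_mul (‖f‖ ^ 2)).mono' (hm.pow 2)
    (ae_of_all _ fun s => ?_)
  rw [Real.norm_of_nonneg (sq_nonneg _), ← mul_pow, sq_le_sq, abs_of_nonneg (a := ‖f‖ * _)
    (by positivity)]
  exact abs_real_inner_le_norm _ _

/-- The covariance identity determines `T f` weakly; pairing with every `g` identifies it with the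
integral operator applied to `f`. -/
theorem apply_ae_eq_inner_kernelSection (ha : -1 < a) {T : WeightedL2 a →L[ℝ] WeightedL2 a}
    (hsym : ∀ f g, inner ℝ (T f) g = inner ℝ f (T g))
    (hT : ∀ f g, inner ℝ (T f) g = ∫ s in Set.Ioi 0, ∫ t in Set.Ioi 0,
        K0 s t * f s * g t * Real.exp (-a * s) * Real.exp (-a * t)) (f : WeightedL2 a) :
    T f =ᵐ[expWeight a] fun s => inner ℝ f (kernelSection ha s) := by
  have h : T f = (memLp_inner_kernelSection ha f).toLp := by
    refine ext_inner_left ℝ fun g => ?_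
    rw [← hsym, hT, L2.inner_def]
    have h1 : ∫ s, inner ℝ (g s) ((memLp_inner_kernelSection ha f).toLp _ s) ∂expWeight a =
        ∫ s, g s * inner ℝ f (kernelSection ha s) ∂expWeight a := by
      refine integral_congr_ae ?_
      filter_upwards [(memLp_inner_kernelSection ha f).coeFn_toLp] with s hs
      rw [hs]
      simp [mul_comm]
    rw [h1, integral_expWeight]
    congr 1 with s
    rw [inner_kernelSection_right, integral_expWeight, mul_right_comm, ← integral_const_mul]
    congr 1 with t
    ring
  rw [h]
  exact (memLp_inner_kernelSection ha f).coeFn_toLp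

end Kernel

/-! ### Iterated kernels and traces -/

section Iterates

variable {a : ℝ} {T : WeightedL2 a →L[ℝ] WeightedL2 a}

/-- Integrating an almost-everywhere identity gives the next iterate at every point. The pointwise
form is needed because the diagonal, where the trace is taken, is a null set. -/
theorem iterK_succ_ae_eq_and_iterK_add_two (ha : -1 < a)
    (hT : ∀ f : WeightedL2 a, T f =ᵐ[expWeight a] fun s => inner ℝ f (kernelSection ha s))
    (n : ℕ) (s : ℝ) :
    iterK a (n + 1) s =ᵐ[expWeight a] (T ^ n) (kernelSection ha s) ∧
      ∀ t, iterK a (n + 2) s t = inner ℝ ((T ^ n) (kernelSection ha s)) (kernelSection ha t) := by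
  have step : ∀ n, iterK a (n + 1) s =ᵐ[expWeight a] (T ^ n) (kernelSection ha s) →
      ∀ t, iterK a (n + 2) s t =
        inner ℝ ((T ^ n) (kernelSection ha s)) (kernelSection ha t) := fun n h t => by
    rw [inner_kernelSection_right, iterK]
    beta_reduce
    rw [← integral_expWeight fun u => iterK a (n + 1) s u * K0 u t]
    refine integral_congr_ae ?_
    filter_upwards [h] with u hu
    rw [hu, K0_comm]
  have h1 : iterK a (n + 1) s =ᵐ[expWeight a] (T ^ n) (kernelSection ha s) := by
    induction n with
    | zero => simpa [kernelSection, iterK] using! (memLp_K0 ha s).coeFn_toLp.symm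
    | succ n ih =>
      have h := hT ((T ^ n) (kernelSection ha s))
      rw [pow_succ']
      filter_upwards [h] with t ht
      rw [step n ih t, ← ht]
      rfl
  exact ⟨h1, step n h1⟩

theorem integrableOn_iterK_mul_K0 (ha : -1 < a)
    (hT : ∀ f : WeightedL2 a, T f =ᵐ[expWeight a] fun s => inner ℝ f (kernelSection ha s))
    (n : ℕ) (s t : ℝ) :
    IntegrableOn (fun u => iterK a (n + 1) s u * K0 u t * Real.exp (-a * u)) (Set.Ioi 0) := by
  rw [← integrable_expWeight_iff (f := fun u => iterK a (n + 1) s u * K0 u t)]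
  have h := (Lp.memLp ((T ^ n) (kernelSection ha s))).integrable_mul (memLp_K0 ha t)
  refine h.congr ?_
  filter_upwards [(iterK_succ_ae_eq_and_iterK_add_two ha hT n s).1] with u hu
  rw [Pi.mul_apply, ← hu, K0_comm]

variable {ι : Type*} [Countable ι] (b : HilbertBasis ι ℝ (WeightedL2 a)) {l : ι → ℝ}

theorem inner_pow_apply_of_eigenbasis {H : Type*} [NormedAddCommGroup H] [InnerProductSpace ℝ H]
    {T : H →L[ℝ] H} (hsym : ∀ f g, inner ℝ (T f) g = inner ℝ f (T g)) {e : H} {m : ℝ}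
    (he : T e = m • e) (n : ℕ) (x : H) : inner ℝ e ((T ^ n) x) = m ^ n * inner ℝ e x := by
  induction n with
  | zero => simp
  | succ n ih =>
    rw [pow_succ', mul_apply_eq_comp, ← hsym, he, inner_smul_left, ih]
    simp only [conj_trivial]
    ring

theorem integral_sq_eq_sq_norm (f : WeightedL2 a) : ∫ t, f t ^ 2 ∂expWeight a = ‖f‖ ^ 2 := by
  rw [← real_inner_self_eq_norm_sq, L2.inner_def]
  refine integral_congr_ae (ae_of_all _ fun t => ?_)
  simp [sq]

/-- The $i$-th coordinate of the section at $t$ is $l_ib_i(t)$ for almost every $t$. Two sections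
contribute $l_i^2b_i(t)^2$ and $T^n$ contributes $l_i^n$; each $b_i^2$ integrates to $1$. -/
theorem integrable_and_hasSum_iterK_diag (ha : -1 < a)
    (hT : ∀ f : WeightedL2 a, T f =ᵐ[expWeight a] fun s => inner ℝ f (kernelSection ha s))
    (hsym : ∀ f g, inner ℝ (T f) g = inner ℝ f (T g)) (hb : ∀ i, T (b i) = l i • b i)
    (hl0 : ∀ i, 0 ≤ l i) (hl : Summable l) (n : ℕ) :
    Integrable (fun t => iterK a (n + 2) t t) (expWeight a) ∧
      HasSum (fun i => l i ^ (n + 2)) (∫ t, iterK a (n + 2) t t ∂expWeight a) := by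
  have hsq : ∀ i, Integrable (fun t => b i t ^ 2) (expWeight a) := fun i =>
    (Lp.memLp (b i)).integrable_sq
  have hint : ∀ i, ∫ t, l i ^ (n + 2) * b i t ^ 2 ∂expWeight a = l i ^ (n + 2) := fun i => by
    rw [integral_const_mul, integral_sq_eq_sq_norm, b.orthonormal.1 i]
    simp
  have hsum : Summable fun i => l i ^ (n + 2) := by
    have hle : ∀ i, l i ≤ ∑' i, l i := fun i => hl.le_tsum i fun j _ => hl0 j
    refine (hl.mul_left ((∑' i, l i) ^ (n + 1))).of_nonneg_of_le (fun i => by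
      have := hl0 i; positivity) fun i => ?_
    rw [pow_succ]
    exact mul_le_mul_of_nonneg_right (pow_le_pow_left₀ (hl0 i) (hle i) _) (hl0 i)
  have hpt : ∀ᵐ t ∂expWeight a,
      HasSum (fun i => l i ^ (n + 2) * b i t ^ 2) (iterK a (n + 2) t t) := by
    have hall : ∀ᵐ t ∂expWeight a, ∀ i, l i * b i t = inner ℝ (b i) (kernelSection ha t) := by
      refine ae_all_iff.2 fun i => ?_
      have h1 := hT (b i)
      rw [hb] at h1
      filter_upwards [h1, Lp.coeFn_smul (l i) (b i)] with t h1 h2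
      rw [← h1, h2, Pi.smul_apply, smul_eq_mul]
    filter_upwards [hall] with t ht
    rw [(iterK_succ_ae_eq_and_iterK_add_two ha hT n t).2 t]
    refine (b.hasSum_inner_mul_inner _ _).congr_fun fun i => ?_
    rw [real_inner_comm, inner_pow_apply_of_eigenbasis hsym (hb i), ← ht i]
    ring
  have := integrable_and_hasSum_integral_of_nonneg (f := fun i t => l i ^ (n + 2) * b i t ^ 2)
    (fun i => (hsq i).const_mul _)
    (fun i => ae_of_all _ fun t => by have := hl0 i; positivity) (by simpa only [hint] using hsum)
    hpt
  simpa only [hint] using this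

end Iterates

/-! ### The trace of the covariance operator through a square root of the kernel -/

section Trace

variable {a : ℝ}

/-- A square root of the kernel `K0`: one has `K0 s t = ∫ u in Ioi 0, rootK s u * rootK t u`. -/
noncomputable def rootK (s u : ℝ) : ℝ :=
  if u * (1 - Real.exp (-s)) < Real.exp (-s) then 1 - Real.exp (-s) else 0

theorem measurable_rootK : Measurable (Function.uncurry rootK) := by
  unfold Function.uncurry rootK
  exact Measurable.ite (measurableSet_lt (by fun_prop) (by fun_prop)) (by fun_prop) (by fun_prop)

theorem rootK_nonneg {s : ℝ} (hs : 0 < s) (u : ℝ) : 0 ≤ rootK s u := by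
  have : Real.exp (-s) < 1 := by simpa using hs
  unfold rootK
  split_ifs <;> linarith

/-- Makes each section `rootK · u`, $u>0$, square integrable for the weight, so that Parseval
applies to it. -/
theorem rootK_le {s u : ℝ} (hu : 0 < u) : rootK s u ≤ u⁻¹ * Real.exp (-s) := by
  unfold rootK
  split_ifs with h
  · rw [inv_mul_eq_div, le_div_iff₀ hu, mul_comm]
    exact h.le
  · positivity

/-- With the decreasing function $h(s)=e^{-s}/(1-e^{-s})$ one has
$K_0(s,t)=(1-e^{-s})(1-e^{-t})\min(h(s),h(t))$, and the minimum is the length of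
$(0,h(s))\cap(0,h(t))$. -/
theorem lintegral_rootK_mul_rootK {s t : ℝ} (hs : 0 < s) (ht : 0 < t) :
    ∫⁻ u in Set.Ioi 0, ENNReal.ofReal (rootK s u * rootK t u) = ENNReal.ofReal (K0 s t) := by
  wlog h : s ≤ t generalizing s t
  · rw [K0_comm, ← this ht hs (le_of_not_ge h)]
    simp only [mul_comm]
  have hs1 : 0 < 1 - Real.exp (-s) := by
    simpa using hs
  have ht1 : 0 < 1 - Real.exp (-t) := by
    simpa using ht
  have hst : Real.exp (-t) ≤ Real.exp (-s) := Real.exp_le_exp.2 (by linarith)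
  set g := Real.exp (-t) / (1 - Real.exp (-t)) with hg
  have hfun : ∀ u ∈ Set.Ioi (0 : ℝ), ENNReal.ofReal (rootK s u * rootK t u) =
      (Set.Iio g).indicator
        (fun _ => ENNReal.ofReal ((1 - Real.exp (-s)) * (1 - Real.exp (-t)))) u := by
    intro u hu
    have hu0 : 0 < u := hu
    by_cases hug : u < g
    · have h1 : u * (1 - Real.exp (-t)) < Real.exp (-t) := (lt_div_iff₀ ht1).1 hug
      have h2 : u * (1 - Real.exp (-s)) < Real.exp (-s) := by nlinarith
      rw [Set.indicator_of_mem (show u ∈ Set.Iio g from hug), rootK, rootK, if_pos h1, if_pos h2]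
    · have h1 : ¬u * (1 - Real.exp (-t)) < Real.exp (-t) := fun h' => hug ((lt_div_iff₀ ht1).2 h')
      rw [Set.indicator_of_notMem (show u ∉ Set.Iio g from hug), rootK, rootK, if_neg h1]
      simp
  rw [setLIntegral_congr_fun measurableSet_Ioi hfun, lintegral_indicator_const measurableSet_Iio,
    Measure.restrict_apply measurableSet_Iio, Set.inter_comm, Set.Ioi_inter_Iio, Real.volume_Ioo,
    ← ENNReal.ofReal_mul (by positivity), K0_of_le h, hg]
  congr 1
  field_simp
  ring

theorem integrable_and_integral_rootK_mul_rootK {s t : ℝ} (hs : 0 < s) (ht : 0 < t) :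
    IntegrableOn (fun u => rootK s u * rootK t u) (Set.Ioi 0) ∧
      ∫ u in Set.Ioi 0, rootK s u * rootK t u = K0 s t := by
  have hm : ∀ s, Measurable fun u => rootK s u := fun s => measurable_rootK.of_uncurry_left
  have h0 : ∀ u, 0 ≤ rootK s u * rootK t u := fun u =>
    mul_nonneg (rootK_nonneg hs u) (rootK_nonneg ht u)
  have hl := lintegral_rootK_mul_rootK hs ht
  have hae : AEStronglyMeasurable (fun u => rootK s u * rootK t u)
      (volume.restrict (Set.Ioi 0)) := ((hm s).mul (hm t)).aestronglyMeasurable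
  constructor
  · refine ⟨hae, ?_⟩
    rw [hasFiniteIntegral_iff_ofReal (ae_of_all _ h0), hl]
    exact ENNReal.ofReal_lt_top
  · rw [integral_eq_lintegral_of_nonneg_ae (ae_of_all _ h0) hae, hl,
      ENNReal.toReal_ofReal (K0_nonneg hs.le ht.le)]

theorem memLp_rootK (ha : -1 < a) {u : ℝ} (hu : 0 < u) :
    MemLp (fun s => rootK s u) 2 (expWeight a) := by
  have hm : Measurable fun s => rootK s u := measurable_rootK.of_uncurry_right
  have h : MemLp (fun t => u⁻¹ * Real.exp (-t)) 2 (expWeight a) := by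
    refine MemLp.const_mul ?_ _
    rw [memLp_two_iff_integrable_sq (by fun_prop)]
    refine (integrable_exp_neg_expWeight (a := a) (c := 2) (by linarith)).congr
      (ae_of_all _ fun t => ?_)
    simp only [sq, ← Real.exp_add]
    ring_nf
  refine h.of_le hm.aestronglyMeasurable ?_
  filter_upwards [ae_pos_expWeight] with s hs
  rw [Real.norm_of_nonneg (rootK_nonneg hs u)]
  exact (rootK_le hu).trans (le_abs_self _)

theorem inner_toLp_right {f : WeightedL2 a} {g : ℝ → ℝ} (hg : MemLp g 2 (expWeight a)) :
    inner ℝ f hg.toLp = ∫ s, f s * g s ∂expWeight a := by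
  rw [L2.inner_def]
  refine integral_congr_ae ?_
  filter_upwards [hg.coeFn_toLp] with t ht
  rw [ht]
  simp [mul_comm]

theorem integrable_K0_diag (ha : -1 < a) : Integrable (fun s => K0 s s) (expWeight a) := by
  refine ((integrable_exp_neg_expWeight (a := a) (c := 1) (by linarith)).sub
    (integrable_exp_neg_expWeight (a := a) (c := 2) (by linarith))).congr (ae_of_all _ fun s => ?_)
  simp only [Pi.sub_apply, K0, max_self]
  ring_nf

theorem integrable_rootK_sq_prod (ha : -1 < a) :
    Integrable (fun p : ℝ × ℝ => rootK p.1 p.2 ^ 2)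
      ((expWeight a).prod (volume.restrict (Set.Ioi 0))) := by
  have hm : Measurable fun p : ℝ × ℝ => rootK p.1 p.2 ^ 2 := measurable_rootK.pow_const 2
  rw [integrable_prod_iff hm.aestronglyMeasurable]
  constructor
  · filter_upwards [ae_pos_expWeight] with s hs
    simpa only [sq, IntegrableOn] using (integrable_and_integral_rootK_mul_rootK hs hs).1
  · refine (integrable_K0_diag ha).congr ?_
    filter_upwards [ae_pos_expWeight] with s hs
    simp only [norm_pow, Real.norm_eq_abs, sq_abs]
    simp only [sq, (integrable_and_integral_rootK_mul_rootK hs hs).2]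

theorem integral_integral_K0_mul_mul (ha : -1 < a) (f : WeightedL2 a) :
    ∫ s, f s * inner ℝ f (kernelSection ha s) ∂expWeight a =
      ∫ u in Set.Ioi 0, (∫ s, f s * rootK s u ∂expWeight a) ^ 2 := by
  set μ := expWeight a with hμ
  have hf : StronglyMeasurable f := Lp.stronglyMeasurable f
  have hpos : ∀ᵐ p ∂μ.prod μ, 0 < p.1 ∧ 0 < p.2 := ae_pos_prod_expWeight
  have hKff : Integrable (fun p : ℝ × ℝ => f p.1 * f p.2 * K0 p.1 p.2) (μ.prod μ) := by
    have h1 : MemLp (fun p : ℝ × ℝ => f p.1 * f p.2) 2 (μ.prod μ) := by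
      have hm : StronglyMeasurable fun p : ℝ × ℝ => f p.1 * f p.2 :=
        (hf.comp_measurable measurable_fst).mul (hf.comp_measurable measurable_snd)
      rw [memLp_two_iff_integrable_sq hm.aestronglyMeasurable]
      have := (Lp.memLp f).integrable_sq
      exact (this.mul_prod this).congr (ae_of_all _ fun p => by simp [mul_pow])
    have h2 : MemLp (fun p : ℝ × ℝ => K0 p.1 p.2) 2 (μ.prod μ) :=
      (memLp_two_iff_integrable_sq continuous_uncurry_K0.aestronglyMeasurable).2
        (integrable_K0_sq_prod ha)
    exact h1.integrable_mul h2
  let F : (ℝ × ℝ) × ℝ → ℝ := fun q => f q.1.1 * f q.1.2 * (rootK q.1.1 q.2 * rootK q.1.2 q.2)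
  -- Since `rootK` is nonnegative, integrating $|F|$ over $u$ gives $|f(s)f(t)|K_0(s,t)$, which is
  -- integrable.
  have hF : Integrable F ((μ.prod μ).prod (volume.restrict (Set.Ioi 0))) := by
    have hm : Measurable F := by
      have := hf.measurable
      have h1 : Measurable fun q : (ℝ × ℝ) × ℝ => rootK q.1.1 q.2 :=
        measurable_rootK.comp (by fun_prop : Measurable fun q : (ℝ × ℝ) × ℝ => (q.1.1, q.2))
      have h2 : Measurable fun q : (ℝ × ℝ) × ℝ => rootK q.1.2 q.2 :=
        measurable_rootK.comp (by fun_prop : Measurable fun q : (ℝ × ℝ) × ℝ => (q.1.2, q.2))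
      fun_prop
    rw [integrable_prod_iff hm.aestronglyMeasurable]
    constructor
    · filter_upwards [hpos] with p hp
      exact (integrable_and_integral_rootK_mul_rootK hp.1 hp.2).1.const_mul (f p.1 * f p.2)
    · refine hKff.norm.congr ?_
      filter_upwards [hpos] with p hp
      have : ∀ u, ‖F (p, u)‖ = ‖f p.1 * f p.2‖ * (rootK p.1 u * rootK p.2 u) := fun u => by
        rw [norm_mul, Real.norm_of_nonneg
          (mul_nonneg (rootK_nonneg hp.1 u) (rootK_nonneg hp.2 u))]
      simp only [this]
      rw [integral_const_mul, (integrable_and_integral_rootK_mul_rootK hp.1 hp.2).2, norm_mul,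
        Real.norm_of_nonneg (K0_nonneg hp.1.le hp.2.le)]
  calc ∫ s, f s * inner ℝ f (kernelSection ha s) ∂μ
      = ∫ s, ∫ t, f s * f t * K0 s t ∂μ ∂μ := by
        congr 1 with s
        rw [inner_kernelSection_right, ← integral_const_mul]
        simp only [mul_assoc, hμ]
    _ = ∫ p, f p.1 * f p.2 * K0 p.1 p.2 ∂μ.prod μ := (integral_prod _ hKff).symm
    _ = ∫ p, (∫ u in Set.Ioi 0, F (p, u)) ∂μ.prod μ := by
        refine integral_congr_ae ?_
        filter_upwards [hpos] with p hp
        simp only [F]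
        rw [integral_const_mul, (integrable_and_integral_rootK_mul_rootK hp.1 hp.2).2]
    _ = ∫ u in Set.Ioi 0, ∫ p, F (p, u) ∂μ.prod μ := integral_integral_swap hF
    _ = ∫ u in Set.Ioi 0, (∫ s, f s * rootK s u ∂μ) ^ 2 := by
        congr 1 with u
        rw [sq, ← integral_prod_mul]
        congr 1 with p
        simp only [F]
        ring

/-- Each term equals $\int\langle b_i,\rho_u\rangle^2\,du$ with $\rho_u$ the section of `rootK` at
$u$. Parseval sums the integrands to $\|\rho_u\|^2$, and Tonelli returns the integral of the
diagonal. -/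
theorem hasSum_integral_K0_diag {ι : Type*} [Countable ι] (ha : -1 < a)
    (b : HilbertBasis ι ℝ (WeightedL2 a)) :
    HasSum (fun i => ∫ s, b i s * inner ℝ (b i) (kernelSection ha s) ∂expWeight a)
      (∫ s, K0 s s ∂expWeight a) := by
  have hint := integrable_rootK_sq_prod ha
  have hval : ∫ s, K0 s s ∂expWeight a =
      ∫ u in Set.Ioi 0, ∫ s, rootK s u ^ 2 ∂expWeight a := by
    rw [← integral_integral_swap (f := fun s u => rootK s u ^ 2) hint]
    refine integral_congr_ae ?_
    filter_upwards [ae_pos_expWeight] with s hs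
    simp only [sq, (integrable_and_integral_rootK_mul_rootK hs hs).2]
  have hsum : ∀ u ∈ Set.Ioi (0 : ℝ), HasSum (fun i => (∫ s, b i s * rootK s u ∂expWeight a) ^ 2)
      (∫ s, rootK s u ^ 2 ∂expWeight a) := fun u hu => by
    have h := b.hasSum_sq_inner (memLp_rootK ha hu).toLp
    simp only [inner_toLp_right] at h
    convert h using 1
    rw [← integral_sq_eq_sq_norm]
    refine integral_congr_ae ?_
    filter_upwards [(memLp_rootK ha hu).coeFn_toLp] with s hs
    rw [hs]
  simp only [integral_integral_K0_mul_mul, hval]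
  have hgi : IntegrableOn (fun u => ∫ s, rootK s u ^ 2 ∂expWeight a) (Set.Ioi 0) :=
    hint.integral_prod_right
  have hae : ∀ᵐ u ∂volume.restrict (Set.Ioi (0 : ℝ)), HasSum
      (fun i => (∫ s, b i s * rootK s u ∂expWeight a) ^ 2) (∫ s, rootK s u ^ 2 ∂expWeight a) :=
    (ae_restrict_mem measurableSet_Ioi).mono hsum
  refine hasSum_integral_of_nonneg_of_integrable (fun i => ?_)
    (fun i => ae_of_all _ fun u => sq_nonneg _) hgi hae
  refine hgi.mono' ?_ ?_
  · have h : StronglyMeasurable fun p : ℝ × ℝ => b i p.2 * rootK p.2 p.1 :=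
      ((Lp.stronglyMeasurable (b i)).comp_measurable measurable_snd).mul
        (measurable_rootK.comp measurable_swap).stronglyMeasurable
    exact (h.integral_prod_right'.pow 2).aestronglyMeasurable
  · filter_upwards [hae] with u hu
    rw [Real.norm_of_nonneg (sq_nonneg _)]
    exact le_hasSum hu i fun j _ => sq_nonneg _

end Trace

/-! ### Explicit integrals -/

section Moments

variable {a : ℝ}

/-- The function `s ↦ exp (-s) * ∫ u in 0..s, (1 - exp (-u)) ^ 2 * exp (-a * u)`. -/
noncomputable def lowerPart (a s : ℝ) : ℝ :=
  Real.exp (-s) * ∫ u in (0 : ℝ)..s, (1 - Real.exp (-u)) ^ 2 * Real.exp (-a * u)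

theorem lowerPart_zero : lowerPart a 0 = 0 := by simp [lowerPart]

/-- This equation is all that the moment recursion uses. Keeping `lowerPart` unevaluated avoids a
closed form that divides by $a$ and breaks at $a=0$. -/
theorem hasDerivAt_lowerPart (s : ℝ) : HasDerivAt (lowerPart a)
    (-lowerPart a s + (1 - Real.exp (-s)) ^ 2 * Real.exp (-(1 + a) * s)) s := by
  have hc : Continuous fun u : ℝ => (1 - Real.exp (-u)) ^ 2 * Real.exp (-a * u) := by fun_prop
  have h1 : HasDerivAt (fun s => ∫ u in (0 : ℝ)..s, (1 - Real.exp (-u)) ^ 2 * Real.exp (-a * u))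
      ((1 - Real.exp (-s)) ^ 2 * Real.exp (-a * s)) s :=
    intervalIntegral.integral_hasDerivAt_right (hc.intervalIntegrable _ _)
      (hc.stronglyMeasurableAtFilter _ _) hc.continuousAt
  have h2 : HasDerivAt (fun s : ℝ => Real.exp (-s)) (Real.exp (-s) * -1) s :=
    (hasDerivAt_neg s).exp
  refine (h2.mul h1).congr_deriv ?_
  rw [lowerPart, show -(1 + a) * s = -s + -a * s by ring, Real.exp_add]
  ring

theorem continuous_lowerPart : Continuous (lowerPart a) :=
  continuous_iff_continuousAt.2 fun s => (hasDerivAt_lowerPart s).continuousAt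

theorem abs_lowerPart_le (ha : -1 < a) {s : ℝ} (hs : 0 ≤ s) : |lowerPart a s| ≤ (1 + a)⁻¹ := by
  have h1a : 0 < 1 + a := by linarith
  have hcont : Continuous fun u : ℝ => (1 - Real.exp (-u)) ^ 2 * Real.exp (-a * u) := by fun_prop
  have h0 : 0 ≤ lowerPart a s := mul_nonneg (Real.exp_nonneg _)
    (intervalIntegral.integral_nonneg hs fun u _ => by positivity)
  have hd : ∀ u : ℝ, HasDerivAt (fun u => -Real.exp (-(1 + a) * u) / (1 + a))
      (Real.exp (-(1 + a) * u)) u := fun u => by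
    have := ((((hasDerivAt_id u).const_mul (-(1 + a))).exp).neg).div_const (1 + a)
    refine this.congr_deriv ?_
    simp only [id, mul_one]
    field_simp
  rw [abs_of_nonneg h0, lowerPart, ← intervalIntegral.integral_const_mul]
  calc ∫ u in (0 : ℝ)..s, Real.exp (-s) * ((1 - Real.exp (-u)) ^ 2 * Real.exp (-a * u))
      ≤ ∫ u in (0 : ℝ)..s, Real.exp (-(1 + a) * u) := by
        refine intervalIntegral.integral_mono_on hs
          ((hcont.const_mul _).intervalIntegrable _ _)
          (Continuous.intervalIntegrable (by fun_prop) _ _) fun u hu => ?_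
        have e1 : Real.exp (-s) ≤ Real.exp (-u) := Real.exp_le_exp.2 (by linarith [hu.2])
        have e2 : Real.exp (-u) ≤ 1 := by simpa using hu.1
        have e3 : (1 - Real.exp (-u)) ^ 2 ≤ 1 := by nlinarith [Real.exp_pos (-u)]
        calc Real.exp (-s) * ((1 - Real.exp (-u)) ^ 2 * Real.exp (-a * u))
            ≤ Real.exp (-u) * (1 * Real.exp (-a * u)) := by gcongr
          _ = Real.exp (-(1 + a) * u) := by rw [one_mul, ← Real.exp_add]; ring_nf
    _ = -Real.exp (-(1 + a) * s) / (1 + a) - -Real.exp (-(1 + a) * 0) / (1 + a) :=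
        intervalIntegral.integral_eq_sub_of_hasDerivAt (fun u _ => hd u)
          (Continuous.intervalIntegrable (by fun_prop) _ _)
    _ ≤ (1 + a)⁻¹ := by
        have : 0 ≤ Real.exp (-(1 + a) * s) / (1 + a) := by positivity
        rw [mul_zero, Real.exp_zero, inv_eq_one_div, neg_div, neg_div]
        linarith

/-- The monomials in `exp (-s)`, `exp (-(1 + a) * s)` and `lowerPart a s`. -/
noncomputable def expMonomial (a : ℝ) (m n k : ℕ) (s : ℝ) : ℝ :=
  Real.exp (-s) ^ m * Real.exp (-(1 + a) * s) ^ n * lowerPart a s ^ k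

/-- The integrals of the functions `expMonomial a m n k` over the half line, for `n ≠ 0`. -/
noncomputable def expMoment (a : ℝ) : ℕ → ℕ → ℕ → ℝ
  | m, n, 0 => 1 / (m + n * (1 + a))
  | m, n, k + 1 => (k + 1) / (m + n * (1 + a) + (k + 1)) *
      (expMoment a m (n + 1) k - 2 * expMoment a (m + 1) (n + 1) k + expMoment a (m + 2) (n + 1) k)

theorem exp_pow_mul_exp_pow (a : ℝ) (m n : ℕ) (s : ℝ) :
    Real.exp (-s) ^ m * Real.exp (-(1 + a) * s) ^ n = Real.exp (-(m + n * (1 + a)) * s) := by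
  rw [← Real.exp_nat_mul, ← Real.exp_nat_mul, ← Real.exp_add]
  ring_nf

theorem integrableOn_expMonomial (ha : -1 < a) (m k : ℕ) {n : ℕ} (hn : n ≠ 0) :
    IntegrableOn (expMonomial a m n k) (Set.Ioi 0) := by
  have hc : 0 < (m + n * (1 + a) : ℝ) := by
    have : (0 : ℝ) < n := by positivity
    have : 0 < 1 + a := by linarith
    positivity
  have := (exp_neg_integrableOn_Ioi 0 hc).mul_const ((1 + a)⁻¹ ^ k)
  refine this.mono' ?_ ?_
  · refine Continuous.aestronglyMeasurable ?_
    unfold expMonomial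
    have := continuous_lowerPart (a := a)
    fun_prop
  · filter_upwards [ae_restrict_mem measurableSet_Ioi] with s hs
    rw [expMonomial, exp_pow_mul_exp_pow, norm_mul, norm_pow, Real.norm_eq_abs, Real.abs_exp,
      Real.norm_eq_abs]
    gcongr
    exact abs_lowerPart_le ha (Set.mem_Ioi.1 hs).le

/-- Integrate the derivative of the monomial over the half line. The boundary terms vanish, at $0$
because `lowerPart` does and at infinity by exponential decay; what remains is the recursion for the
moments. -/
theorem integral_expMonomial (ha : -1 < a) (m k : ℕ) {n : ℕ} (hn : n ≠ 0) :
    ∫ s in Set.Ioi 0, expMonomial a m n k s = expMoment a m n k := by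
  induction k generalizing m n with
  | zero =>
    have hc : 0 < (m + n * (1 + a) : ℝ) := by
      have : (0 : ℝ) < n := by positivity
      have : 0 < 1 + a := by linarith
      positivity
    simp only [expMonomial, exp_pow_mul_exp_pow, pow_zero, mul_one]
    rw [integral_exp_mul_Ioi (by linarith), expMoment, mul_zero, Real.exp_zero, neg_div_neg_eq]
  | succ k ih =>
    have hc : 0 < (m + n * (1 + a) : ℝ) := by
      have : (0 : ℝ) < n := by positivity
      have : 0 < 1 + a := by linarith
      positivity
    set c : ℝ := m + n * (1 + a) with hcdef
    let G' : ℝ → ℝ := fun s => -(c + (k + 1)) * expMonomial a m n (k + 1) s + (k + 1) *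
      (expMonomial a m (n + 1) k s - 2 * expMonomial a (m + 1) (n + 1) k s +
        expMonomial a (m + 2) (n + 1) k s)
    have hd : ∀ s, HasDerivAt (expMonomial a m n (k + 1)) (G' s) s := fun s => by
      have h1 : HasDerivAt (fun s => Real.exp (-c * s)) (Real.exp (-c * s) * -c) s := by
        simpa using ((hasDerivAt_id s).const_mul (-c)).exp
      have h2 := (hasDerivAt_lowerPart (a := a) s).pow (k + 1)
      have h3 := h1.mul h2
      have hfun : expMonomial a m n (k + 1) =
          fun s => Real.exp (-c * s) * lowerPart a s ^ (k + 1) := by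
        funext s; rw [expMonomial, exp_pow_mul_exp_pow]
      rw [hfun]
      refine h3.congr_deriv ?_
      simp only [G', expMonomial, Pi.pow_apply]
      rw [hcdef, ← exp_pow_mul_exp_pow]
      push_cast
      ring_nf
    have hi := fun m k => integrableOn_expMonomial ha m k (Nat.succ_ne_zero n)
    have hi0 := integrableOn_expMonomial ha m (k + 1) hn
    have hI : IntegrableOn (fun s => expMonomial a m (n + 1) k s -
        2 * expMonomial a (m + 1) (n + 1) k s + expMonomial a (m + 2) (n + 1) k s) (Set.Ioi 0) :=
      ((hi m k).sub ((hi (m + 1) k).const_mul 2)).add (hi (m + 2) k)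
    have hsub : IntegrableOn (fun s => expMonomial a m (n + 1) k s -
        2 * expMonomial a (m + 1) (n + 1) k s) (Set.Ioi 0) :=
      (hi m k).sub ((hi (m + 1) k).const_mul 2)
    have hG' : IntegrableOn G' (Set.Ioi 0) := (hi0.const_mul _).add (hI.const_mul _)
    have hlim : Tendsto (expMonomial a m n (k + 1)) atTop (𝓝 0) := by
      have he : Tendsto (fun s => Real.exp (-c * s) * (1 + a)⁻¹ ^ (k + 1)) atTop (𝓝 0) := by
        have : Tendsto (fun s : ℝ => Real.exp (-c * s)) atTop (𝓝 0) :=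
          Real.tendsto_exp_atBot.comp (tendsto_id.const_mul_atTop_of_neg (by linarith))
        simpa using this.mul_const _
      refine squeeze_zero_norm' ?_ he
      filter_upwards [eventually_ge_atTop 0] with s hs
      rw [expMonomial, exp_pow_mul_exp_pow, norm_mul, norm_pow, Real.norm_eq_abs, Real.abs_exp,
        Real.norm_eq_abs]
      gcongr
      exact abs_lowerPart_le ha hs
    have hint := integral_Ioi_of_hasDerivAt_of_tendsto' (fun s _ => hd s) hG' hlim
    rw [integral_add (hi0.const_mul _) (hI.const_mul _), integral_const_mul, integral_const_mul,
      integral_add hsub (hi (m + 2) k),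
      integral_sub (hi m k) ((hi (m + 1) k).const_mul 2), integral_const_mul,
      ih m (Nat.succ_ne_zero n), ih (m + 1) (Nat.succ_ne_zero n), ih (m + 2) (Nat.succ_ne_zero n)]
      at hint
    have h0 : expMonomial a m n (k + 1) 0 = 0 := by simp [expMonomial, lowerPart_zero]
    rw [h0] at hint
    rw [expMoment, ← hcdef, div_mul_eq_mul_div, eq_div_iff (by positivity)]
    linarith

/-- An entry of `L` lists a coefficient and then the exponents `m`, `n`, `k`. -/
theorem integral_sum_expMonomial (ha : -1 < a) (L : List (ℝ × ℕ × ℕ × ℕ))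
    (hL : ∀ p ∈ L, p.2.2.1 ≠ 0) :
    ∫ s in Set.Ioi 0, (L.map fun p => p.1 * expMonomial a p.2.1 p.2.2.1 p.2.2.2 s).sum =
      (L.map fun p => p.1 * expMoment a p.2.1 p.2.2.1 p.2.2.2).sum := by
  suffices h : IntegrableOn
      (fun s => (L.map fun p => p.1 * expMonomial a p.2.1 p.2.2.1 p.2.2.2 s).sum) (Set.Ioi 0) ∧
      ∫ s in Set.Ioi 0, (L.map fun p => p.1 * expMonomial a p.2.1 p.2.2.1 p.2.2.2 s).sum =
      (L.map fun p => p.1 * expMoment a p.2.1 p.2.2.1 p.2.2.2).sum from h.2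
  induction L with
  | nil => simp
  | cons p L ih =>
    obtain ⟨h1, h2⟩ := ih fun q hq => hL q (List.mem_cons_of_mem _ hq)
    have hp := hL p List.mem_cons_self
    have hi := (integrableOn_expMonomial ha p.2.1 p.2.2.2 hp).const_mul p.1
    simp only [List.map_cons, List.sum_cons]
    refine ⟨hi.add h1, ?_⟩
    rw [integral_add hi h1, h2, integral_const_mul, integral_expMonomial ha _ _ hp]

end Moments

/-! ### Reduction of symmetric double integrals to one side of the diagonal -/

section Symmetric

theorem integral_integral_eq_two_mul_of_symm {μ : Measure ℝ} [SigmaFinite μ] [NullSingletonClass μ]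
    {G : ℝ → ℝ → ℝ} (hG : Integrable (Function.uncurry G) (μ.prod μ))
    (hsymm : ∀ s t, G s t = G t s) :
    ∫ s, ∫ t, G s t ∂μ ∂μ = 2 * ∫ s, ∫ t in Set.Ioi s, G s t ∂μ ∂μ := by
  let A : Set (ℝ × ℝ) := {p | p.1 < p.2}
  have hA : MeasurableSet A := measurableSet_lt measurable_fst measurable_snd
  have h1 : Integrable (A.indicator (Function.uncurry G)) (μ.prod μ) := hG.indicator hA
  have h2 : Integrable (Aᶜ.indicator (Function.uncurry G)) (μ.prod μ) := hG.indicator hA.compl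
  have e1 : ∫ p, A.indicator (Function.uncurry G) p ∂μ.prod μ =
      ∫ s, ∫ t in Set.Ioi s, G s t ∂μ ∂μ := by
    rw [integral_prod _ h1]
    congr 1 with s
    rw [← integral_indicator measurableSet_Ioi]
    rfl
  have e2 : ∫ p, Aᶜ.indicator (Function.uncurry G) p ∂μ.prod μ =
      ∫ s, ∫ t in Set.Ioi s, G s t ∂μ ∂μ := by
    rw [integral_prod_symm _ h2]
    congr 1 with s
    -- The complement of $s<t$ contains the diagonal, which is negligible since points have measure
    -- zero.
    rw [← integral_Ici_eq_integral_Ioi, ← integral_indicator measurableSet_Ici]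
    congr 1 with t
    by_cases h : s ≤ t
    · rw [Set.indicator_of_mem (show (t, s) ∈ Aᶜ from not_lt.2 h),
        Set.indicator_of_mem (show t ∈ Set.Ici s from h)]
      exact hsymm t s
    · rw [Set.indicator_of_notMem (show (t, s) ∉ Aᶜ from not_not.2 (not_le.1 h)),
        Set.indicator_of_notMem (show t ∉ Set.Ici s from h)]
  calc ∫ s, ∫ t, G s t ∂μ ∂μ = ∫ p, Function.uncurry G p ∂μ.prod μ := (integral_prod _ hG).symm
    _ = ∫ p, (A.indicator (Function.uncurry G) p + Aᶜ.indicator (Function.uncurry G) p)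
        ∂μ.prod μ := by
        congr 1 with p
        exact (Set.indicator_self_add_compl_apply A _ p).symm
    _ = _ := by rw [integral_add h1 h2, e1, e2]; ring

instance (a : ℝ) : NullSingletonClass (expWeight a) := by
  unfold expWeight
  infer_instance

theorem setIntegral_Ioi_expWeight {a s : ℝ} (hs : 0 ≤ s) (f : ℝ → ℝ) :
    ∫ t in Set.Ioi s, f t ∂expWeight a = ∫ t in Set.Ioi s, f t * Real.exp (-a * t) := by
  rw [← integral_indicator measurableSet_Ioi, integral_expWeight,
    ← integral_indicator measurableSet_Ioi, ← integral_indicator measurableSet_Ioi]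
  congr 1 with t
  by_cases h : s < t
  · rw [Set.indicator_of_mem (show t ∈ Set.Ioi 0 from hs.trans_lt h),
      Set.indicator_of_mem (show t ∈ Set.Ioi s from h),
      Set.indicator_of_mem (show t ∈ Set.Ioi s from h)]
  · simp [Set.indicator, h]

theorem integral_integral_expWeight_of_symm {a : ℝ} {G : ℝ → ℝ → ℝ}
    (hG : Integrable (Function.uncurry G) ((expWeight a).prod (expWeight a)))
    (hsymm : ∀ s t, G s t = G t s) {g : ℝ → ℝ}
    (hg : ∀ s, 0 < s →
      (∫ t in Set.Ioi s, G s t * Real.exp (-a * t)) * Real.exp (-a * s) = g s) :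
    ∫ s, ∫ t, G s t ∂expWeight a ∂expWeight a = 2 * ∫ s in Set.Ioi 0, g s := by
  rw [integral_integral_eq_two_mul_of_symm hG hsymm, integral_expWeight]
  congr 1
  refine setIntegral_congr_fun measurableSet_Ioi fun s hs => ?_
  rw [setIntegral_Ioi_expWeight (le_of_lt hs), hg s hs]

end Symmetric

/-! ### The second iterated kernel and the double integrals -/

section Second

variable {a : ℝ}

theorem iterK_two (a s t : ℝ) :
    iterK a 2 s t = ∫ u in Set.Ioi 0, K0 s u * K0 u t * Real.exp (-a * u) := rfl

theorem iterK_two_comm (a s t : ℝ) : iterK a 2 s t = iterK a 2 t s := by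
  rw [iterK_two, iterK_two]
  congr 1 with u
  rw [K0_comm s u, K0_comm u t]
  ring

theorem stronglyMeasurable_iterK_two (a : ℝ) :
    StronglyMeasurable fun p : ℝ × ℝ => iterK a 2 p.1 p.2 := by
  have h : Continuous fun q : (ℝ × ℝ) × ℝ =>
      K0 q.1.1 q.2 * K0 q.2 q.1.2 * Real.exp (-a * q.2) := by
    unfold K0
    fun_prop
  exact h.stronglyMeasurable.integral_prod_right'

/-- The coefficient of `exp (-t)` in `iterK a 2 s t` for `s ≤ t`. -/
noncomputable def leadCoeff (a s : ℝ) : ℝ :=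
  lowerPart a s + (1 - Real.exp (-s)) * (Real.exp (-(1 + a) * s) / (1 + a) -
    Real.exp (-s) * Real.exp (-(1 + a) * s) / (2 + a))

/-- The integral is split at $s$ and $t$, since on each piece both maxima are explicit; the piece
below $s$ produces `lowerPart`. -/
theorem iterK_two_of_le (ha : -1 < a) {s t : ℝ} (hs : 0 < s) (hst : s ≤ t) :
    iterK a 2 s t = leadCoeff a s * Real.exp (-t) -
      (1 - Real.exp (-s)) / ((1 + a) * (2 + a)) * Real.exp (-(2 + a) * t) := by
  have h1a : 0 < 1 + a := by linarith
  have h2a : 0 < 2 + a := by linarith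
  have hint : IntegrableOn (fun u => K0 s u * K0 u t * Real.exp (-a * u)) (Set.Ioi 0) := by
    rw [← integrable_expWeight_iff (f := fun u => K0 s u * K0 u t)]
    simpa only [K0_comm _ t] using! (memLp_K0 ha s).integrable_mul (memLp_K0 ha t)
  have hd : ∀ c : ℝ, c ≠ 0 → ∀ u : ℝ, HasDerivAt (fun u => -Real.exp (-c * u) / c)
      (Real.exp (-c * u)) u := fun c hc u => by
    have := ((((hasDerivAt_id u).const_mul (-c)).exp).neg).div_const c
    refine this.congr_deriv ?_
    simp only [id, mul_one]
    field_simp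
  have hA : ∫ u in Set.Ioc 0 s, K0 s u * K0 u t * Real.exp (-a * u) =
      Real.exp (-t) * lowerPart a s := by
    rw [lowerPart, ← mul_assoc, intervalIntegral.integral_of_le hs.le, ← integral_const_mul]
    refine setIntegral_congr_fun measurableSet_Ioc fun u hu => ?_
    rw [K0_comm, K0_of_le hu.2, K0_of_le (hu.2.trans hst)]
    ring
  have hB : ∫ u in Set.Ioc s t, K0 s u * K0 u t * Real.exp (-a * u) =
      (1 - Real.exp (-s)) * Real.exp (-t) *
        ((Real.exp (-(1 + a) * s) - Real.exp (-(1 + a) * t)) / (1 + a) -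
          (Real.exp (-(2 + a) * s) - Real.exp (-(2 + a) * t)) / (2 + a)) := by
    have h1 : ∫ u in Set.Ioc s t, K0 s u * K0 u t * Real.exp (-a * u) =
        (1 - Real.exp (-s)) * Real.exp (-t) *
          ∫ u in s..t, (Real.exp (-(1 + a) * u) - Real.exp (-(2 + a) * u)) := by
      rw [intervalIntegral.integral_of_le hst, ← integral_const_mul]
      refine setIntegral_congr_fun measurableSet_Ioc fun u hu => ?_
      rw [K0_of_le hu.1.le, K0_of_le hu.2, show -(1 + a) * u = -u + -a * u by ring,
        show -(2 + a) * u = -u + -u + -a * u by ring, Real.exp_add, Real.exp_add, Real.exp_add]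
      ring
    rw [h1, intervalIntegral.integral_eq_sub_of_hasDerivAt
      (fun u _ => (hd (1 + a) h1a.ne' u).sub (hd (2 + a) h2a.ne' u))
      (Continuous.intervalIntegrable (by fun_prop) _ _)]
    simp only [Pi.sub_apply]
    ring
  have hC : ∫ u in Set.Ioi t, K0 s u * K0 u t * Real.exp (-a * u) =
      (1 - Real.exp (-s)) * (1 - Real.exp (-t)) * (Real.exp (-(2 + a) * t) / (2 + a)) := by
    have h1 : ∫ u in Set.Ioi t, K0 s u * K0 u t * Real.exp (-a * u) =
        (1 - Real.exp (-s)) * (1 - Real.exp (-t)) * ∫ u in Set.Ioi t, Real.exp (-(2 + a) * u) := by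
      rw [← integral_const_mul]
      refine setIntegral_congr_fun measurableSet_Ioi fun u hu => ?_
      have hu' : t ≤ u := le_of_lt hu
      rw [K0_of_le (hst.trans hu'), K0_comm u t, K0_of_le hu',
        show -(2 + a) * u = -u + -u + -a * u by ring, Real.exp_add, Real.exp_add]
      ring
    rw [h1, integral_exp_mul_Ioi (by linarith), neg_div_neg_eq]
  have ht : 0 < t := hs.trans_le hst
  rw [iterK_two, ← Set.Ioc_union_Ioi_eq_Ioi ht.le, setIntegral_union
    (Set.Ioc_disjoint_Ioi le_rfl) measurableSet_Ioi (hint.mono_set Set.Ioc_subset_Ioi_self)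
    (hint.mono_set (Set.Ioi_subset_Ioi ht.le)), ← Set.Ioc_union_Ioc_eq_Ioc hs.le hst,
    setIntegral_union (Set.Ioc_disjoint_Ioc_of_le le_rfl) measurableSet_Ioc
      (hint.mono_set Set.Ioc_subset_Ioi_self)
      (hint.mono_set fun u hu => hs.trans hu.1), hA, hB, hC, leadCoeff,
    show -(1 + a) * t = t + -(2 + a) * t by ring, Real.exp_add,
    show -(2 + a) * s = -s + -(1 + a) * s by ring, Real.exp_add (-s)]
  have he : Real.exp t * Real.exp (-t) = 1 := by rw [← Real.exp_add]; simp
  generalize Real.exp (-(2 + a) * t) = E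
  field_simp
  linear_combination (-(1 - Real.exp (-s)) * E * (2 + a)) * he

/-- After weighting in $s$, the exponents that occur are multiples of $1+a$, which yields powers of
$e^{-(1+a)s}$. -/
theorem integral_exp_mul_exp_Ioi {c : ℝ} (hc : 0 < c) {n : ℕ} (h : c + a = n * (1 + a)) (s : ℝ) :
    (∫ t in Set.Ioi s, Real.exp (-c * t)) * Real.exp (-a * s) =
      Real.exp (-(1 + a) * s) ^ n / c := by
  rw [integral_exp_mul_Ioi (by linarith), neg_div_neg_eq, div_mul_eq_mul_div, ← Real.exp_add,
    ← Real.exp_nat_mul]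
  congr 2
  linear_combination -s * h

theorem memLp_K0_prod (ha : -1 < a) :
    MemLp (fun p : ℝ × ℝ => K0 p.1 p.2) 2 ((expWeight a).prod (expWeight a)) :=
  (memLp_two_iff_integrable_sq continuous_uncurry_K0.aestronglyMeasurable).2
    (integrable_K0_sq_prod ha)

theorem integral_integral_K0_sq (ha : -1 < a) :
    ∫ s, ∫ t, K0 s t ^ 2 ∂expWeight a ∂expWeight a =
      1 / ((a ^ 2 + 3 * a + 2) * (2 * a + 3) * (a + 2)) := by
  have h1 : 0 < 1 + a := by linarith
  have h2 : 0 < 2 + a := by linarith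
  have h3 : 0 < 3 + 2 * a := by linarith
  rw [integral_integral_expWeight_of_symm (G := fun s t => K0 s t ^ 2) (integrable_K0_sq_prod ha)
    (fun s t => by rw [K0_comm]) (g := fun s => ((
      [(1 / (2 + a), 0, 2, 0), (-2 / (2 + a), 1, 2, 0), (1 / (2 + a), 2, 2, 0)] :
        List (ℝ × ℕ × ℕ × ℕ)).map fun p => p.1 * expMonomial a p.2.1 p.2.2.1 p.2.2.2 s).sum) ?_,
    integral_sum_expMonomial ha _ (by simp)]
  · simp only [List.map_cons, List.map_nil, List.sum_cons, List.sum_nil, expMoment]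
    have h4 : a ^ 2 + 3 * a + 2 ≠ 0 := by nlinarith
    push_cast
    rw [eq_div_iff (by have : 2 * a + 3 ≠ 0 := by linarith
                       have : a + 2 ≠ 0 := by linarith
                       positivity)]
    field_simp
    ring
  · intro s hs
    have : ∀ t ∈ Set.Ioi s, K0 s t ^ 2 * Real.exp (-a * t) =
        (1 - Real.exp (-s)) ^ 2 * Real.exp (-(2 + a) * t) := fun t ht => by
      rw [K0_of_le (le_of_lt ht), show -(2 + a) * t = -t + -t + -a * t by ring, Real.exp_add,
        Real.exp_add]
      ring
    rw [setIntegral_congr_fun measurableSet_Ioi this, integral_const_mul, mul_assoc,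
      integral_exp_mul_exp_Ioi h2 (n := 2) (by push_cast; ring)]
    simp only [List.map_cons, List.map_nil, List.sum_cons, List.sum_nil, expMonomial]
    ring

theorem integral_integral_iterK_two_mul_K0 (ha : -1 < a)
    (hK : MemLp (fun p : ℝ × ℝ => iterK a 2 p.1 p.2) 2 ((expWeight a).prod (expWeight a))) :
    ∫ s, ∫ t, iterK a 2 s t * K0 s t ∂expWeight a ∂expWeight a =
      2 / ((1 + a) * (2 * a + 3) * (a + 2) ^ 3 * (3 * a + 4)) := by
  have h1 : 0 < 1 + a := by linarith
  have h2 : 0 < 2 + a := by linarith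
  have h3 : 0 < 3 + 2 * a := by linarith
  rw [integral_integral_expWeight_of_symm (G := fun s t => iterK a 2 s t * K0 s t)
    (hK.integrable_mul (memLp_K0_prod ha))
    (fun s t => by rw [K0_comm, iterK_two_comm]) (g := fun s => ((
      [(1 / (2 + a), 0, 2, 1), (-1 / (2 + a), 1, 2, 1),
        (1 / ((1 + a) * (2 + a)) - 1 / ((1 + a) * (2 + a) * (3 + 2 * a)), 0, 3, 0),
        (-2 / ((1 + a) * (2 + a)) - 1 / (2 + a) ^ 2 + 2 / ((1 + a) * (2 + a) * (3 + 2 * a)),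
          1, 3, 0),
        (1 / ((1 + a) * (2 + a)) + 2 / (2 + a) ^ 2 - 1 / ((1 + a) * (2 + a) * (3 + 2 * a)),
          2, 3, 0),
        (-1 / (2 + a) ^ 2, 3, 3, 0)] :
        List (ℝ × ℕ × ℕ × ℕ)).map fun p => p.1 * expMonomial a p.2.1 p.2.2.1 p.2.2.2 s).sum) ?_,
    integral_sum_expMonomial ha _ (by simp)]
  · simp only [List.map_cons, List.map_nil, List.sum_cons, List.sum_nil, expMoment]
    -- In terms of $b=a+1>0$ every denominator has nonnegative coefficients, so it is visibly
    -- nonzero.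
    obtain ⟨b, rfl⟩ : ∃ b, a = b - 1 := ⟨a + 1, by ring⟩
    have hb : 0 < b := by linarith
    simp only [show 1 + (b - 1) = b by ring, show 2 + (b - 1) = b + 1 by ring,
      show 3 + 2 * (b - 1) = 2 * b + 1 by ring, show 2 * (b - 1) + 3 = 2 * b + 1 by ring,
      show b - 1 + 2 = b + 1 by ring, show 3 * (b - 1) + 4 = 3 * b + 1 by ring]
    push_cast
    field_simp
    ring
  · intro s hs
    have hK0 : ∀ t ∈ Set.Ioi s, iterK a 2 s t * K0 s t * Real.exp (-a * t) =
        (1 - Real.exp (-s)) * leadCoeff a s * Real.exp (-(2 + a) * t) -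
          (1 - Real.exp (-s)) ^ 2 / ((1 + a) * (2 + a)) * Real.exp (-(3 + 2 * a) * t) :=
      fun t ht => by
        rw [iterK_two_of_le ha hs (le_of_lt ht), K0_of_le (le_of_lt ht),
          show -(3 + 2 * a) * t = -(2 + a) * t + -t + -a * t by ring, Real.exp_add, Real.exp_add,
          show -(2 + a) * t = -t + -t + -a * t by ring, Real.exp_add, Real.exp_add]
        ring
    rw [setIntegral_congr_fun measurableSet_Ioi hK0, integral_sub
      ((integrableOn_exp_mul_Ioi (by linarith) s).const_mul _)
      ((integrableOn_exp_mul_Ioi (by linarith) s).const_mul _), integral_const_mul,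
      integral_const_mul, sub_mul, mul_assoc, mul_assoc _ _ (Real.exp (-a * s)),
      integral_exp_mul_exp_Ioi h2 (n := 2) (by push_cast; ring),
      integral_exp_mul_exp_Ioi h3 (n := 3) (by push_cast; ring), leadCoeff]
    simp only [List.map_cons, List.map_nil, List.sum_cons, List.sum_nil, expMonomial]
    generalize Real.exp (-(1 + a) * s) = Q
    field_simp
    ring

theorem integral_integral_iterK_two_sq (ha : -1 < a)
    (hK : MemLp (fun p : ℝ × ℝ => iterK a 2 p.1 p.2) 2 ((expWeight a).prod (expWeight a))) :
    ∫ s, ∫ t, iterK a 2 s t ^ 2 ∂expWeight a ∂expWeight a =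
      (11 * a + 16) / ((3 * a + 4) * (2 * a + 3) ^ 2 * (a + 2) ^ 4 * (1 + a) * (4 * a + 5)) := by
  have h1 : 0 < 1 + a := by linarith
  have h2 : 0 < 2 + a := by linarith
  have h3 : 0 < 3 + 2 * a := by linarith
  have h4 : 0 < 4 + 3 * a := by linarith
  -- The reciprocals are kept as opaque variables, so that matching the integrand with the list of
  -- monomials is a polynomial identity.
  obtain ⟨p, hp⟩ : ∃ p, p = 1 / (1 + a) := ⟨_, rfl⟩
  obtain ⟨r, hr⟩ : ∃ r, r = 1 / (2 + a) := ⟨_, rfl⟩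
  obtain ⟨w, hw⟩ : ∃ w, w = 1 / (3 + 2 * a) := ⟨_, rfl⟩
  obtain ⟨x, hx⟩ : ∃ x, x = 1 / (4 + 3 * a) := ⟨_, rfl⟩
  rw [integral_integral_expWeight_of_symm (G := fun s t => iterK a 2 s t ^ 2)
    hK.integrable_sq (fun s t => by rw [iterK_two_comm]) (g := fun s => ((
      [(r, 0, 2, 2), (2 * r * p - 2 * p * r * w, 0, 3, 1),
        (-2 * r * (p + r) + 2 * p * r * w, 1, 3, 1), (2 * r * r, 2, 3, 1),
        (r * p ^ 2 - 2 * p * r * w * p + p ^ 2 * r ^ 2 * x, 0, 4, 0),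
        (-2 * r * p * (p + r) + 2 * p * r * w * (2 * p + r) - 2 * p ^ 2 * r ^ 2 * x, 1, 4, 0),
        (r * ((p + r) ^ 2 + 2 * p * r) - 2 * p * r * w * (p + 2 * r) + p ^ 2 * r ^ 2 * x, 2, 4, 0),
        (-2 * r * r * (p + r) + 2 * p * r * w * r, 3, 4, 0), (r * r ^ 2, 4, 4, 0)] :
        List (ℝ × ℕ × ℕ × ℕ)).map fun p => p.1 * expMonomial a p.2.1 p.2.2.1 p.2.2.2 s).sum) ?_,
    integral_sum_expMonomial ha _ (by simp)]
  · simp only [List.map_cons, List.map_nil, List.sum_cons, List.sum_nil, expMoment]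
    obtain ⟨b, rfl⟩ : ∃ b, a = b - 1 := ⟨a + 1, by ring⟩
    have hb : 0 < b := by linarith
    simp only [hp, hr, hw, hx, show 1 + (b - 1) = b by ring, show 2 + (b - 1) = b + 1 by ring,
      show 3 + 2 * (b - 1) = 2 * b + 1 by ring, show 2 * (b - 1) + 3 = 2 * b + 1 by ring,
      show 4 + 3 * (b - 1) = 3 * b + 1 by ring,
      show b - 1 + 2 = b + 1 by ring, show 3 * (b - 1) + 4 = 3 * b + 1 by ring,
      show 4 * (b - 1) + 5 = 4 * b + 1 by ring]
    push_cast
    field_simp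
    ring
  · intro s hs
    have hK0 : ∀ t ∈ Set.Ioi s, iterK a 2 s t ^ 2 * Real.exp (-a * t) =
        leadCoeff a s ^ 2 * Real.exp (-(2 + a) * t) -
          2 * leadCoeff a s * ((1 - Real.exp (-s)) * p * r) * Real.exp (-(3 + 2 * a) * t) +
          ((1 - Real.exp (-s)) * p * r) ^ 2 * Real.exp (-(4 + 3 * a) * t) :=
      fun t ht => by
        rw [iterK_two_of_le ha hs (le_of_lt ht), hp, hr,
          show -(4 + 3 * a) * t = -(2 + a) * t + -(2 + a) * t + -a * t by ring, Real.exp_add,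
          Real.exp_add, show -(3 + 2 * a) * t = -(2 + a) * t + -t + -a * t by ring, Real.exp_add,
          Real.exp_add]
        have : Real.exp (-(2 + a) * t) = Real.exp (-t) * Real.exp (-t) * Real.exp (-a * t) := by
          rw [← Real.exp_add, ← Real.exp_add]; ring_nf
        rw [this]
        generalize Real.exp (-a * t) = E
        field_simp
        ring
    have i1 := integrableOn_exp_mul_Ioi (a := -(2 + a)) (by linarith) s
    have i2 := integrableOn_exp_mul_Ioi (a := -(3 + 2 * a)) (by linarith) s
    have i3 := integrableOn_exp_mul_Ioi (a := -(4 + 3 * a)) (by linarith) s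
    have i12 : IntegrableOn (fun t => leadCoeff a s ^ 2 * Real.exp (-(2 + a) * t) -
        2 * leadCoeff a s * ((1 - Real.exp (-s)) * p * r) * Real.exp (-(3 + 2 * a) * t))
        (Set.Ioi s) := (i1.const_mul _).sub (i2.const_mul _)
    rw [setIntegral_congr_fun measurableSet_Ioi hK0, integral_add i12 (i3.const_mul _),
      integral_sub (i1.const_mul _) (i2.const_mul _), integral_const_mul,
      integral_const_mul, integral_const_mul, add_mul, sub_mul, mul_assoc,
      mul_assoc (2 * leadCoeff a s * _), mul_assoc (_ ^ 2) _ (Real.exp (-a * s)),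
      integral_exp_mul_exp_Ioi h2 (n := 2) (by push_cast; ring),
      integral_exp_mul_exp_Ioi h3 (n := 3) (by push_cast; ring),
      integral_exp_mul_exp_Ioi h4 (n := 4) (by push_cast; ring), leadCoeff]
    simp only [List.map_cons, List.map_nil, List.sum_cons, List.sum_nil, expMonomial]
    generalize Real.exp (-(1 + a) * s) = Q
    simp only [div_eq_mul_one_div Q, div_eq_mul_one_div (Real.exp (-s) * Q),
      div_eq_mul_one_div (Q ^ 2), div_eq_mul_one_div (Q ^ 3), div_eq_mul_one_div (Q ^ 4),
      ← hp, ← hr, ← hw, ← hx]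
    ring

end Second

/-! ### Values of the traces -/

section Traces

variable {a : ℝ} {T : WeightedL2 a →L[ℝ] WeightedL2 a}

theorem iterK_two_ae_eq (ha : -1 < a)
    (hT : ∀ f : WeightedL2 a, T f =ᵐ[expWeight a] fun s => inner ℝ f (kernelSection ha s))
    (s : ℝ) : iterK a 2 s =ᵐ[expWeight a] T (kernelSection ha s) := by
  simpa using (iterK_succ_ae_eq_and_iterK_add_two ha hT 1 s).1

/-- By symmetry $\langle T^2k_s,k_s\rangle=\|Tk_s\|^2$, and $Tk_s$ is the section of the second
iterate. -/
theorem iterK_four_diag (ha : -1 < a)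
    (hT : ∀ f : WeightedL2 a, T f =ᵐ[expWeight a] fun s => inner ℝ f (kernelSection ha s))
    (hsym : ∀ f g, inner ℝ (T f) g = inner ℝ f (T g)) (s : ℝ) :
    iterK a 4 s s = ∫ t, iterK a 2 s t ^ 2 ∂expWeight a := by
  rw [(iterK_succ_ae_eq_and_iterK_add_two ha hT 2 s).2 s, sq T, mul_apply_eq_comp, hsym,
    real_inner_self_eq_norm_sq, ← integral_sq_eq_sq_norm]
  refine integral_congr_ae ?_
  filter_upwards [iterK_two_ae_eq ha hT s] with t ht
  rw [← ht]

/-- The inner integral of $K_2^2$ is the diagonal of the fourth iterate, so integrability of that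
diagonal suffices. -/
theorem memLp_iterK_two_prod (ha : -1 < a)
    (hT : ∀ f : WeightedL2 a, T f =ᵐ[expWeight a] fun s => inner ℝ f (kernelSection ha s))
    (hsym : ∀ f g, inner ℝ (T f) g = inner ℝ f (T g))
    (hint : Integrable (fun t => iterK a 4 t t) (expWeight a)) :
    MemLp (fun p : ℝ × ℝ => iterK a 2 p.1 p.2) 2 ((expWeight a).prod (expWeight a)) := by
  have hm := stronglyMeasurable_iterK_two a
  have hm2 : StronglyMeasurable fun p : ℝ × ℝ => iterK a 2 p.1 p.2 ^ 2 := hm.pow 2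
  rw [memLp_two_iff_integrable_sq hm.aestronglyMeasurable,
    integrable_prod_iff hm2.aestronglyMeasurable]
  constructor
  · refine ae_of_all _ fun s => (Lp.memLp (T (kernelSection ha s))).integrable_sq.congr ?_
    filter_upwards [iterK_two_ae_eq ha hT s] with t ht
    rw [← ht]
  · refine hint.congr (ae_of_all _ fun s => ?_)
    simp only [norm_pow, Real.norm_eq_abs, sq_abs]
    exact iterK_four_diag ha hT hsym s

theorem integral_iterK_three_diag (ha : -1 < a)
    (hK : MemLp (fun p : ℝ × ℝ => iterK a 2 p.1 p.2) 2 ((expWeight a).prod (expWeight a))) :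
    ∫ s, iterK a 3 s s ∂expWeight a =
      2 / ((1 + a) * (2 * a + 3) * (a + 2) ^ 3 * (3 * a + 4)) := by
  rw [← integral_integral_iterK_two_mul_K0 ha hK]
  congr 1 with s
  rw [integral_expWeight]
  change ∫ u in Set.Ioi 0, iterK a 2 s u * K0 u s * Real.exp (-a * u) = _
  simp only [K0_comm s]

theorem integral_iterK_four_diag (ha : -1 < a)
    (hT : ∀ f : WeightedL2 a, T f =ᵐ[expWeight a] fun s => inner ℝ f (kernelSection ha s))
    (hsym : ∀ f g, inner ℝ (T f) g = inner ℝ f (T g))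
    (hK : MemLp (fun p : ℝ × ℝ => iterK a 2 p.1 p.2) 2 ((expWeight a).prod (expWeight a))) :
    ∫ s, iterK a 4 s s ∂expWeight a =
      (11 * a + 16) / ((3 * a + 4) * (2 * a + 3) ^ 2 * (a + 2) ^ 4 * (1 + a) * (4 * a + 5)) := by
  simp only [iterK_four_diag ha hT hsym, integral_integral_iterK_two_sq ha hK]

theorem integral_K0_diag (ha : -1 < a) :
    ∫ s, K0 s s ∂expWeight a = 1 / ((a + 1) * (a + 2)) := by
  have h1 : 0 < a + 1 := by linarith
  have h2 : 0 < a + 2 := by linarith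
  rw [integral_expWeight]
  have h : ∀ t ∈ Set.Ioi (0 : ℝ), K0 t t * Real.exp (-a * t) =
      Real.exp (-(a + 1) * t) - Real.exp (-(a + 2) * t) := fun t _ => by
    rw [K0_of_le le_rfl, show -(a + 1) * t = -t + -a * t by ring,
      show -(a + 2) * t = -t + -t + -a * t by ring, Real.exp_add, Real.exp_add, Real.exp_add]
    ring
  rw [setIntegral_congr_fun measurableSet_Ioi h, integral_sub
    (integrableOn_exp_mul_Ioi (by linarith) 0) (integrableOn_exp_mul_Ioi (by linarith) 0),
    integral_exp_mul_Ioi (by linarith), integral_exp_mul_Ioi (by linarith)]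
  simp only [mul_zero, Real.exp_zero, neg_div_neg_eq]
  field_simp
  ring

theorem integrableOn_K0_sq (ha : -1 < a) :
    IntegrableOn (fun p : ℝ × ℝ => K0 p.1 p.2 ^ 2 * Real.exp (-a * (p.1 + p.2)))
      (Set.Ioi 0 ×ˢ Set.Ioi 0) := by
  have he : IntegrableOn (fun t : ℝ => Real.exp (-(1 + a) * t)) (Set.Ioi 0) :=
    integrableOn_exp_mul_Ioi (by linarith) 0
  have hm : Continuous fun p : ℝ × ℝ => K0 p.1 p.2 ^ 2 * Real.exp (-a * (p.1 + p.2)) := by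
    unfold K0
    fun_prop
  have hp := he.mul_prod he
  rw [Measure.prod_restrict, ← Measure.volume_eq_prod] at hp
  refine hp.mono' hm.aestronglyMeasurable ?_
  filter_upwards [ae_restrict_mem (measurableSet_Ioi.prod measurableSet_Ioi)] with p hp
  rw [Real.norm_of_nonneg (by positivity)]
  calc K0 p.1 p.2 ^ 2 * Real.exp (-a * (p.1 + p.2))
      ≤ Real.exp (-p.1) * Real.exp (-p.2) * Real.exp (-a * (p.1 + p.2)) := by
        gcongr
        exact K0_sq_le (le_of_lt hp.1) (le_of_lt hp.2)
    _ = Real.exp (-(1 + a) * p.1) * Real.exp (-(1 + a) * p.2) := by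
        simp only [← Real.exp_add]
        ring_nf

theorem integral_integral_K0_sq_mul_exp (a : ℝ) :
    ∫ s in Set.Ioi 0, ∫ t in Set.Ioi 0, K0 s t ^ 2 * Real.exp (-a * (s + t)) =
      ∫ s, ∫ t, K0 s t ^ 2 ∂expWeight a ∂expWeight a := by
  rw [integral_expWeight]
  congr 1 with s
  rw [integral_expWeight, ← integral_mul_const]
  congr 1 with t
  rw [mul_assoc, ← Real.exp_add]
  ring_nf

end Traces

/-! ### Low-order cumulants and the main theorem -/

theorem cumulant_one_eq_integral {Ω : Type*} [MeasurableSpace Ω] {P : Measure Ω}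
    [IsProbabilityMeasure P] {X : Ω → ℝ} (h : 0 ∈ interior (integrableExpSet X P)) :
    cumulant X P 1 = ∫ ω, X ω ∂P := by
  rw [cumulant, iteratedDeriv_one, deriv_cgf_zero h]
  simp

theorem cumulant_two_eq_variance {Ω : Type*} [MeasurableSpace Ω] {P : Measure Ω}
    [IsProbabilityMeasure P] {X : Ω → ℝ} (h : 0 ∈ interior (integrableExpSet X P)) :
    cumulant X P 2 = variance X P := by
  have hX : AEMeasurable X P := aemeasurable_of_mem_interior_integrableExpSet h
  rw [cumulant, iteratedDeriv_two_cgf_eq_integral h, variance_eq_integral hX, deriv_cgf_zero h]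
  simp

theorem mainTheorem7 {Ω : Type*} [MeasurableSpace Ω] (P : Measure Ω) (a : ℝ) (ha : -1 < a)
    (Z : Ω → WeightedL2 a) (hZ : IsCentredGaussianWithKernel a K0 Z P) :
    -- the moment generating function is finite near `0`, so that all cumulants exist
    (0 ∈ interior (integrableExpSet (fun ω => ‖Z ω‖ ^ 2) P)) ∧
    MemLp (fun ω => ‖Z ω‖ ^ 2) 2 P ∧
    -- the iterated kernels are well defined
    (∀ j : ℕ, 2 ≤ j → ∀ s t : ℝ, 0 < s → 0 < t →
      IntegrableOn (fun u => iterK a (j - 1) s u * K0 u t * Real.exp (-a * u)) (Set.Ioi 0)) ∧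
    -- the general formula
    (∀ j : ℕ, 1 ≤ j →
      IntegrableOn (fun t => iterK a j t t * Real.exp (-a * t)) (Set.Ioi 0) ∧
      cumulant (fun ω => ‖Z ω‖ ^ 2) P j =
        2 ^ (j - 1) * (Nat.factorial (j - 1) : ℝ) *
          ∫ t in Set.Ioi 0, iterK a j t t * Real.exp (-a * t)) ∧
    -- the first cumulant
    (cumulant (fun ω => ‖Z ω‖ ^ 2) P 1 = ∫ ω, ‖Z ω‖ ^ 2 ∂P ∧
      ∫ ω, ‖Z ω‖ ^ 2 ∂P = ∫ t in Set.Ioi 0, K0 t t * Real.exp (-a * t) ∧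
      ∫ t in Set.Ioi 0, K0 t t * Real.exp (-a * t) = 1 / ((a + 1) * (a + 2))) ∧
    -- the second cumulant
    (cumulant (fun ω => ‖Z ω‖ ^ 2) P 2 = variance (fun ω => ‖Z ω‖ ^ 2) P ∧
      IntegrableOn (fun p : ℝ × ℝ => K0 p.1 p.2 ^ 2 * Real.exp (-a * (p.1 + p.2)))
        (Set.Ioi 0 ×ˢ Set.Ioi 0) ∧
      variance (fun ω => ‖Z ω‖ ^ 2) P =
        2 * ∫ s in Set.Ioi 0, ∫ t in Set.Ioi 0, K0 s t ^ 2 * Real.exp (-a * (s + t)) ∧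
      2 * ∫ s in Set.Ioi 0, ∫ t in Set.Ioi 0, K0 s t ^ 2 * Real.exp (-a * (s + t)) =
        2 / ((a ^ 2 + 3 * a + 2) * (2 * a + 3) * (a + 2))) ∧
    -- the third and fourth cumulants
    cumulant (fun ω => ‖Z ω‖ ^ 2) P 3 =
      16 / ((1 + a) * (2 * a + 3) * (a + 2) ^ 3 * (3 * a + 4)) ∧
    cumulant (fun ω => ‖Z ω‖ ^ 2) P 4 =
      48 * (11 * a + 16) /
        ((3 * a + 4) * (2 * a + 3) ^ 2 * (a + 2) ^ 4 * (1 + a) * (4 * a + 5)) := by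
  classical
  have hprob := hZ.gaussian.isProbabilityMeasure
  have h0 := hZ.gaussian.zero_mem_interior_integrableExpSet
  obtain ⟨T, ι, hι, b, l, hTcov, hsym, hb, hl0, hl⟩ :=
    hZ.gaussian.exists_eigenbasis hZ.centred
  have hT := apply_ae_eq_inner_kernelSection ha hsym fun f g =>
    (hTcov f g).trans (hZ.covariance_eq f g)
  have hcov : ∀ i j, cov[fun ω => inner ℝ (b i) (Z ω), fun ω => inner ℝ (b j) (Z ω); P] =
      if i = j then l i else 0 := fun i j => by
    rw [← hTcov, hb, inner_smul_left, orthonormal_iff_ite.1 b.orthonormal i j]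
    simp
  have htr1 : HasSum l (∫ t, K0 t t ∂expWeight a) := by
    convert hasSum_integral_K0_diag ha b using 2 with i
    have h1 : ∫ s, b i s * inner ℝ (b i) (kernelSection ha s) ∂expWeight a =
        inner ℝ (b i) (T (b i)) := by
      rw [L2.inner_def]
      refine integral_congr_ae ?_
      filter_upwards [hT (b i)] with s hs
      rw [hs]
      simp [mul_comm]
    rw [h1, hb, inner_smul_right, real_inner_self_eq_norm_sq, b.orthonormal.1 i]
    simp
  have htr : ∀ n, Integrable (fun t => iterK a (n + 1) t t) (expWeight a) ∧
      HasSum (fun i => l i ^ (n + 1)) (∫ t, iterK a (n + 1) t t ∂expWeight a) := fun n => by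
    cases n with
    | zero => exact ⟨integrable_K0_diag ha, by simpa using! htr1⟩
    | succ n => exact integrable_and_hasSum_iterK_diag b ha hT hsym hb hl0 hl.summable n
  have hcum : ∀ n, cumulant (fun ω => ‖Z ω‖ ^ 2) P (n + 1) =
      2 ^ n * (n.factorial : ℝ) * ∫ t, iterK a (n + 1) t t ∂expWeight a := fun n => by
    rw [hZ.gaussian.cumulant_sq_norm b hZ.centred hcov hl0 hl.summable n, (htr n).2.tsum_eq]
  have hK := memLp_iterK_two_prod ha hT hsym (htr 3).1
  have hc1 := cumulant_one_eq_integral h0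
  have hc2 := cumulant_two_eq_variance h0
  have hsq : ∫ t, iterK a 2 t t ∂expWeight a =
      ∫ s, ∫ t, K0 s t ^ 2 ∂expWeight a ∂expWeight a := by
    congr 1 with s
    rw [iterK_two, integral_expWeight]
    simp only [K0_comm _ s, sq]
  have h2 := integral_integral_K0_sq_mul_exp a
  refine ⟨h0, memLp_of_mem_interior_integrableExpSet h0 2, fun j hj s t _ _ => ?_, fun j hj => ?_,
    ⟨hc1, ?_, ?_⟩, ⟨hc2, integrableOn_K0_sq ha, ?_, ?_⟩, ?_, ?_⟩
  · obtain ⟨n, rfl⟩ := Nat.exists_eq_add_of_le' hj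
    exact integrableOn_iterK_mul_K0 ha hT n s t
  · obtain ⟨n, rfl⟩ := Nat.exists_eq_add_of_le' hj
    refine ⟨integrable_expWeight_iff.1 (htr n).1, ?_⟩
    rw [hcum, integral_expWeight, Nat.add_sub_cancel]
  · rw [← integral_expWeight fun t => K0 t t]
    -- The eigenvalue sum is computed twice, as $\mathbb E\|Z\|^2$ and as the integral of the
    -- diagonal.
    exact hl.unique htr1
  · rw [← integral_expWeight fun t => K0 t t, integral_K0_diag ha]
  · rw [← hc2, hcum 1, h2, hsq]
    simp
  · rw [h2, integral_integral_K0_sq ha]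
    ring
  · rw [hcum 2, integral_iterK_three_diag ha hK, show Nat.factorial 2 = 2 from rfl]
    push_cast
    ring
  · rw [hcum 3, integral_iterK_four_diag ha hT hsym hK, show Nat.factorial 3 = 6 from rfl]
    push_cast
    ring
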